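/- **Setting.** Let $H$ be a real Hilbert space with norm $\|\cdot\|$, let $\Theta\subseteq\mathbb R$ be an interval, and let $\varphi:\Theta\to H$ be a dictionary. Put $\phi(\theta)=\varphi(\theta)/\|\varphi(\theta)\|$. Derivatives on $\Theta$ are one-sided at end points of $\Theta$. For a kernel $\mathcal K$ on $\Theta^2$ put $g_{\mathcal K}(\theta)=\partial^2_{x,y}\mathcal K(\theta,\theta)$ and, when $g_{\mathcal K}>0$, let $\mathfrak d_{\mathcal K}(\theta,\theta')=\bigl|\int_\theta^{\theta'}\sqrt{g_{\mathcal K}(t)}\,dt\bigr|$ (the Riemannian metric), $\mathcal K^{[i,j]}=(g_{\mathcal K}(x)^{-1/2}\partial_x)^i(g_{\mathcal K}(y)^{-1/2}\partial_y)^j\mathcal K$ and $h_{\mathcal K}(\theta)=\mathcal K^{[3,3]}(\theta,\theta)$. Let $\mathcal K_T(\theta,\theta')=\langle\phi(\theta),\phi(\theta')\rangle$ and $\mathfrak d_T=\mathfrak d_{\mathcal K_T}$. Let $\Theta_T\subseteq\Theta_\infty\subseteq\Theta$, where $\Theta_\infty$ is an interval and $\Theta_T=[a,b]$ is a compact interval,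 with Riemannian length $|\Theta_T|_{\mathfrak d_T}=\mathfrak d_T(a,b)$, and let $\mathcal K_\infty$ be a kernel on $\Theta^2$. One observes the random element $y=\sum_{k=1}^K\beta^\star_k\phi(\theta^\star_k)+w$ of $H$, with $\beta^\star\in\mathbb R^K$, $\theta^\star_k\in\Theta_T$ for all $k$, $S^\star=\{k:\beta_k^\star\ne0\}$ and $s=\operatorname{Card}S^\star\ge1$. For $\kappa>0$ let $(\hat\beta,\hat\vartheta)$ be any minimizer of $\tfrac12\|y-\sum_k\beta_k\phi(\theta_k)\|^2+\kappa\sum_k|\beta_k|$ over $\beta\in\mathbb R^K$, $\vartheta=(\theta_1,\dots,\theta_K)\in\Theta_T^K$. **Assumptions.** Let $r>0$. 1. (Noise) There are $\sigma,\Delta>0$ such that for every $f\in H$ the variable $\langle f,w\rangle$ is centered Gaussian (possibly degenerate) with variance at most $\sigma^2\Delta\|f\|^2$. 2. (Dictionary) On $\Theta$, $\varphi$ is of class $C^3$, $\|\varphi\|>0$ and $\|\partial_\theta\phi\|^2>0$. 3. (Limit kernel) $\mathcal K_\infty$ is symmetric and of class $C^{3,3}$ on $\Theta^2$; $g_\infty=g_{\mathcal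 K_\infty}$ is positive and of class $C^2$ on $\Theta$; $\mathcal K_\infty(\theta,\theta)=-\mathcal K_\infty^{[2,0]}(\theta,\theta)=1$ on $\Theta$; and $\inf_{\Theta_\infty}g_\infty>0$, $L_3:=\sup_{\Theta_\infty}h_{\mathcal K_\infty}<\infty$, $L_{i,j}:=\sup_{\Theta_\infty^2}|\mathcal K_\infty^{[i,j]}|<\infty$ for $i,j\in\{0,1,2\}$. 4. (Proximity) $\max\bigl(\max_{0\le i,j\le2}\sup_{\Theta_T^2}|\mathcal K_T^{[i,j]}-\mathcal K_\infty^{[i,j]}|,\ \sup_{\Theta_T}|h_{\mathcal K_T}-h_{\mathcal K_\infty}|\bigr)\le\min(L_{2,2},L_3)$. 5. (Certificates) The points $\theta^\star_k$, $k\in S^\star$, are distinct and at pairwise $\mathfrak d_T$-distance $>2r$; let $\mathcal Q^\star=\{\theta^\star_k:k\in S^\star\}$ and $B(\theta^\star,r)=\{\theta\in\Theta_T:\mathfrak d_T(\theta^\star,\theta)\le r\}$. There are positive constants $C_N,C_N',C_F,C_B,c_N,c_F,c_B$ with $C_F<1$ such that for every $v:\mathcal Q^\star\to\{-1,1\}$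 there are $p,q\in H$ with $\|p\|\le C_B\sqrt s$ and $\|q\|\le c_B\sqrt s$ satisfying: for all $\theta^\star\in\mathcal Q^\star$ and $\theta\in B(\theta^\star,r)$, $|\langle\phi(\theta),p\rangle|\le1-C_N\mathfrak d_T(\theta^\star,\theta)^2$, $|\langle\phi(\theta),p\rangle-v(\theta^\star)|\le C_N'\mathfrak d_T(\theta^\star,\theta)^2$ and $|\langle\phi(\theta),q\rangle-v(\theta^\star)\operatorname{sign}(\theta-\theta^\star)\mathfrak d_T(\theta,\theta^\star)|\le c_N\mathfrak d_T(\theta^\star,\theta)^2$; and for all $\theta\in\Theta_T\setminus\bigcup_{\theta^\star\in\mathcal Q^\star}B(\theta^\star,r)$, $|\langle\phi(\theta),p\rangle|\le1-C_F$ and $|\langle\phi(\theta),q\rangle|\le c_F$. **Theorem 2.** There exist finite positive constants $\mathcal C_1,\dots,\mathcal C_6$, depending only on $r$, on the certificate constants $C_N,C_N',C_F,C_B,c_N,c_F,c_B$, and on $\mathcal K_\infty$ on $\Theta_\infty$ (through $L_{2,2}$ and $L_3$ only), such that under Assumptions 1–5, for all $\tau>0$ and $\kappa>0$ with $\kappa\ge\mathcal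 C_1\sigma\sqrt{\Delta\log\tau}$, there is an event of probability at least $$1-\mathcal C_2\left(\frac{|\Theta_T|_{\mathfrak d_T}}{\tau\sqrt{\log\tau}}\vee\frac1\tau\right)$$ on which every minimizer $(\hat\beta,\hat\vartheta)$ satisfies, with $\tilde S_k(r)=\{\ell:\hat\beta_\ell\ne0,\ \mathfrak d_T(\hat\theta_\ell,\theta^\star_k)\le r\}$, $\tilde S(r)=\bigcup_{k\in S^\star}\tilde S_k(r)$ and empty sums equal to $0$: (i) $\displaystyle\sum_{k\in S^\star}\Bigl||\beta^\star_k|-\sum_{\ell\in\tilde S_k(r)}|\hat\beta_\ell|\Bigr|\le\mathcal C_3\,\kappa\,s$; (ii) $\displaystyle\sum_{k\in S^\star}\Bigl|\beta^\star_k-\sum_{\ell\in\tilde S_k(r)}\hat\beta_\ell\Bigr|\le\mathcal C_4\,\kappa\,s$; (iii) $\displaystyle\sum_{\ell\notin\tilde S(r)}|\hat\beta_\ell|\le\mathcal C_5\,\kappa\,s$; and moreover (the remark following the theorem) $\displaystyle\sum_{k\in S^\star}\sum_{\ell\in\tilde S_k(r)}|\hat\beta_\ell|\,\mathfrak d_T(\hat\theta_\ell,\theta^\star_k)^2\le\mathcal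 C_6\,\kappa\,s$. (For $\tau\le1$, $\sqrt{\log\tau}$, $\sqrt{\Delta\log\tau}$ and the quotient with $\tau\sqrt{\log\tau}$ are read as $0$; the content is in $\tau>1$.) -/

import Mathlib

open MeasureTheory ProbabilityTheory

universe u v

noncomputable section

/-! ### Kernels on an interval `Θ`: derivatives, metric, covariant derivatives

All derivatives are taken within `Θ`, so that they are one-sided at end points of `Θ`. -/

/-- The partial derivative `∂ₓ F` of a function on `Θ × Θ`. -/
def partialX (Θ : Set ℝ) (F : ℝ → ℝ → ℝ) : ℝ → ℝ → ℝ :=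
  fun x y => derivWithin (fun t => F t y) Θ x

/-- The partial derivative `∂_y F` of a function on `Θ × Θ`. -/
def partialY (Θ : Set ℝ) (F : ℝ → ℝ → ℝ) : ℝ → ℝ → ℝ :=
  fun x y => derivWithin (fun t => F x t) Θ y

/-- `F` is of class `C^{i,j}` on `Θ × Θ`. -/
def ClassC (Θ : Set ℝ) : ℕ → ℕ → (ℝ → ℝ → ℝ) → Prop
  | 0, 0, F => ContinuousOn (Function.uncurry F) (Θ ×ˢ Θ)
  | i + 1, 0, F => ContinuousOn (Function.uncurry F) (Θ ×ˢ Θ) ∧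
      (∀ y ∈ Θ, ContDiffOn ℝ ((i + 1 : ℕ) : WithTop ℕ∞) (fun x => F x y) Θ) ∧
      ClassC Θ i 0 (partialX Θ F)
  | 0, j + 1, F => ContinuousOn (Function.uncurry F) (Θ ×ˢ Θ) ∧
      (∀ x ∈ Θ, ContDiffOn ℝ ((j + 1 : ℕ) : WithTop ℕ∞) (fun y => F x y) Θ) ∧
      ClassC Θ 0 j (partialY Θ F)
  | i + 1, j + 1, F => ContinuousOn (Function.uncurry F) (Θ ×ˢ Θ) ∧
      (∀ y ∈ Θ, ContDiffOn ℝ ((i + 1 : ℕ) : WithTop ℕ∞) (fun x => F x y) Θ) ∧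
      ClassC Θ i (j + 1) (partialX Θ F) ∧
      (∀ x ∈ Θ, ContDiffOn ℝ ((j + 1 : ℕ) : WithTop ℕ∞) (fun y => F x y) Θ) ∧
      ClassC Θ (i + 1) j (partialY Θ F)
  termination_by i j => i + j

/-- `g_K(θ) = ∂²_{x,y} K(θ, θ)`. -/
def kernelG (Θ : Set ℝ) (K : ℝ → ℝ → ℝ) (θ : ℝ) : ℝ :=
  partialX Θ (partialY Θ K) θ θ

/-- The Riemannian metric `d_K(θ, θ') = |G(θ) - G(θ')|`, with `G` a primitive of `√g_K`. -/
def riemDist (Θ : Set ℝ) (K : ℝ → ℝ → ℝ) (θ θ' : ℝ) : ℝ :=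
  |∫ t in θ..θ', Real.sqrt (kernelG Θ K t)|

/-- The normalized covariant derivative of order `1` in the first variable. -/
def covX (Θ : Set ℝ) (K : ℝ → ℝ → ℝ) (F : ℝ → ℝ → ℝ) : ℝ → ℝ → ℝ :=
  fun x y => partialX Θ F x y / Real.sqrt (kernelG Θ K x)

/-- The normalized covariant derivative of order `1` in the second variable. -/
def covY (Θ : Set ℝ) (K : ℝ → ℝ → ℝ) (F : ℝ → ℝ → ℝ) : ℝ → ℝ → ℝ :=
  fun x y => partialY Θ F x y / Real.sqrt (kernelG Θ K y)

/-- `K^{[i,j]}`, the normalized covariant derivative of order `(i, j)` of `K` for the metric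
of `K` itself: the operators of order one in each variable are iterated `i` and `j` times. -/
def kernelDeriv (Θ : Set ℝ) (K : ℝ → ℝ → ℝ) (i j : ℕ) : ℝ → ℝ → ℝ :=
  (covX Θ K)^[i] ((covY Θ K)^[j] K)

/-- `h_K(θ) = K^{[3,3]}(θ, θ)`. -/
def kernelH (Θ : Set ℝ) (K : ℝ → ℝ → ℝ) (θ : ℝ) : ℝ :=
  kernelDeriv Θ K 3 3 θ θ

/-! ### The dictionary -/

section Dictionary

variable {H : Type u} [NormedAddCommGroup H] [InnerProductSpace ℝ H]

/-- The normalized feature `φ(θ) / ‖φ(θ)‖`. -/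
def feature (φ : ℝ → H) (θ : ℝ) : H := ‖φ θ‖⁻¹ • φ θ

/-- The kernel of the dictionary, `⟨φ(θ)/‖φ(θ)‖, φ(θ')/‖φ(θ')‖⟩`. -/
def dictKernel (φ : ℝ → H) (θ θ' : ℝ) : ℝ := inner ℝ (feature φ θ) (feature φ θ')

/-- The Riemannian metric of the kernel of the dictionary. -/
def dictDist (Θ : Set ℝ) (φ : ℝ → H) (θ θ' : ℝ) : ℝ := riemDist Θ (dictKernel φ) θ θ'

/-- The dictionary is of class `C³` and does not vanish on `Θ`, and the derivative of the
normalized dictionary does not vanish (that is, its squared norm is positive) on `Θ`. -/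
structure RegularDictionary (Θ : Set ℝ) (φ : ℝ → H) : Prop where
  smooth : ContDiffOn ℝ 3 φ Θ
  norm_pos : ∀ θ ∈ Θ, 0 < ‖φ θ‖
  deriv_pos : ∀ θ ∈ Θ, 0 < ‖derivWithin (feature φ) Θ θ‖ ^ 2

/-! ### The limit kernel -/

/-- `L_{i,j}`, the supremum of `|K^{[i,j]}|` over `Θ∞ × Θ∞` (possibly infinite). -/
def supDeriv (Θ Θinf : Set ℝ) (K : ℝ → ℝ → ℝ) (i j : ℕ) : EReal :=
  ⨆ x ∈ Θinf, ⨆ y ∈ Θinf, ((|kernelDeriv Θ K i j x y| : ℝ) : EReal)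

/-- `L₃`, the supremum of `h_K` over `Θ∞` (possibly infinite). -/
def supH (Θ Θinf : Set ℝ) (K : ℝ → ℝ → ℝ) : EReal :=
  ⨆ x ∈ Θinf, ((kernelH Θ K x : ℝ) : EReal)

/-- `m_g`, the infimum of `g_K` over `Θ∞`. -/
def infG (Θ Θinf : Set ℝ) (K : ℝ → ℝ → ℝ) : EReal :=
  ⨅ x ∈ Θinf, ((kernelG Θ K x : ℝ) : EReal)

/-- The regularity conditions on the limit kernel `K`, defined on `Θ × Θ`, and on the interval
`Θ∞ ⊆ Θ`. (Local boundedness of `g_K` on `Θ` is contained in its continuity.) -/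
structure RegularLimitKernel (Θ Θinf : Set ℝ) (K : ℝ → ℝ → ℝ) : Prop where
  symm : ∀ x ∈ Θ, ∀ y ∈ Θ, K x y = K y x
  classC : ClassC Θ 3 3 K
  g_pos : ∀ θ ∈ Θ, 0 < kernelG Θ K θ
  g_smooth : ContDiffOn ℝ 2 (kernelG Θ K) Θ
  diag : ∀ θ ∈ Θ, K θ θ = 1
  diag_two : ∀ θ ∈ Θ, kernelDeriv Θ K 2 0 θ θ = -1
  subset : Θinf ⊆ Θ
  interval : Θinf.OrdConnected
  infG_pos : 0 < infG Θ Θinf K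
  supH_lt : supH Θ Θinf K < ⊤
  supDeriv_lt : ∀ i ≤ 2, ∀ j ≤ 2, supDeriv Θ Θinf K i j < ⊤

/-- `V_T`, the largest of the uniform distances over `Θ_T × Θ_T` between `K₁^{[i,j]}` and
`K₂^{[i,j]}`, `i, j ≤ 2`, and of the uniform distance over `Θ_T` between `h_{K₁}` and `h_{K₂}`. -/
def kernelGap (Θ ΘT : Set ℝ) (K₁ K₂ : ℝ → ℝ → ℝ) : EReal :=
  max
    (⨆ (i : Fin 3) (j : Fin 3), ⨆ x ∈ ΘT, ⨆ y ∈ ΘT,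
      ((|kernelDeriv Θ K₁ i j x y - kernelDeriv Θ K₂ i j x y| : ℝ) : EReal))
    (⨆ x ∈ ΘT, ((|kernelH Θ K₁ x - kernelH Θ K₂ x| : ℝ) : EReal))

/-! ### Certificates -/

/-- `Q` is a set of `s ≥ 1` points of `Θ_T`, at pairwise Riemannian distance larger than `2 r`. -/
structure SeparatedSet (Θ ΘT : Set ℝ) (φ : ℝ → H) (Q : Finset ℝ) (s : ℕ) (r : ℝ) : Prop where
  one_le : 1 ≤ s
  card_eq : Q.card = s
  subset : ∀ θ ∈ Q, θ ∈ ΘT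
  separated : ∀ θ ∈ Q, ∀ θ' ∈ Q, θ ≠ θ' → 2 * r < dictDist Θ φ θ θ'

/-- Every sign pattern `v` on `Q` has an interpolating certificate, with the given constants. -/
def HasInterpolatingCertificates (Θ ΘT : Set ℝ) (φ : ℝ → H) (Q : Finset ℝ) (s : ℕ)
    (r CN CN' CF CB : ℝ) : Prop :=
  ∀ v : ℝ → ℝ, (∀ θ ∈ Q, v θ = 1 ∨ v θ = -1) → ∃ p : H,
    (∀ θs ∈ Q, ∀ θ ∈ ΘT, dictDist Θ φ θs θ ≤ r →
      |inner ℝ (feature φ θ) p| ≤ 1 - CN * dictDist Θ φ θs θ ^ 2) ∧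
    (∀ θs ∈ Q, ∀ θ ∈ ΘT, dictDist Θ φ θs θ ≤ r →
      |inner ℝ (feature φ θ) p - v θs| ≤ CN' * dictDist Θ φ θs θ ^ 2) ∧
    (∀ θ ∈ ΘT, (∀ θs ∈ Q, r < dictDist Θ φ θs θ) →
      |inner ℝ (feature φ θ) p| ≤ 1 - CF) ∧
    ‖p‖ ≤ CB * Real.sqrt s

/-- Every sign pattern `v` on `Q` has an interpolating derivative certificate, with the given
constants. -/
def HasDerivativeCertificates (Θ ΘT : Set ℝ) (φ : ℝ → H) (Q : Finset ℝ) (s : ℕ)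
    (r cN cF cB : ℝ) : Prop :=
  ∀ v : ℝ → ℝ, (∀ θ ∈ Q, v θ = 1 ∨ v θ = -1) → ∃ q : H,
    (∀ θs ∈ Q, ∀ θ ∈ ΘT, dictDist Θ φ θs θ ≤ r →
      |inner ℝ (feature φ θ) q - v θs * Real.sign (θ - θs) * dictDist Θ φ θ θs|
        ≤ cN * dictDist Θ φ θs θ ^ 2) ∧
    (∀ θ ∈ ΘT, (∀ θs ∈ Q, r < dictDist Θ φ θs θ) →
      |inner ℝ (feature φ θ) q| ≤ cF) ∧
    ‖q‖ ≤ cB * Real.sqrt s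

/-! ### Noise, mixture and estimator -/

/-- For every `f`, the variable `⟨f, w⟩` is centered Gaussian (possibly degenerate) with variance
at most `σ² Δ ‖f‖²`. -/
structure AdmissibleNoise {Ω : Type v} [MeasurableSpace Ω] (P : Measure Ω) (w : Ω → H)
    (σ Δ : ℝ) : Prop where
  sigma_pos : 0 < σ
  delta_pos : 0 < Δ
  gaussian : ∀ f : H, ∃ V : NNReal, HasLaw (fun ω => inner ℝ f (w ω)) (gaussianReal 0 V) P ∧
    (V : ℝ) ≤ σ ^ 2 * Δ * ‖f‖ ^ 2

/-- The mixture `∑ₖ βₖ φ(θₖ)/‖φ(θₖ)‖`. -/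
def mixture {K : ℕ} (φ : ℝ → H) (β θ : Fin K → ℝ) : H := ∑ k, β k • feature φ (θ k)

/-- The penalized least squares functional. -/
def objective {K : ℕ} (φ : ℝ → H) (y : H) (κ : ℝ) (β θ : Fin K → ℝ) : ℝ :=
  1 / 2 * ‖y - mixture φ β θ‖ ^ 2 + κ * ∑ k, |β k|

/-- `(β, θ)` minimizes the functional over `ℝ^K × Θ_T^K`. -/
structure IsEstimator {K : ℕ} (ΘT : Set ℝ) (φ : ℝ → H) (y : H) (κ : ℝ)
    (β θ : Fin K → ℝ) : Prop where
  mem : ∀ k, θ k ∈ ΘT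
  le : ∀ β' θ' : Fin K → ℝ, (∀ k, θ' k ∈ ΘT) →
    objective φ y κ β θ ≤ objective φ y κ β' θ'

/-- The support of a vector. -/
def supp {K : ℕ} (β : Fin K → ℝ) : Finset (Fin K) := Finset.univ.filter fun k => β k ≠ 0

/-- The indices in the support of `β` whose parameter is at Riemannian distance at most `r`
from `t`. -/
def nearAt {K : ℕ} (Θ : Set ℝ) (φ : ℝ → H) (r : ℝ) (β θ : Fin K → ℝ) (t : ℝ) :
    Finset (Fin K) :=
  (supp β).filter fun l => dictDist Θ φ (θ l) t ≤ r

/-- The near region: the union of the sets `nearAt` over the true active parameters. -/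
def nearRegion {K : ℕ} (Θ : Set ℝ) (φ : ℝ → H) (r : ℝ) (βs θs β θ : Fin K → ℝ) :
    Finset (Fin K) :=
  (supp βs).biUnion fun k => nearAt Θ φ r β θ (θs k)

end Dictionary

end

/-! ### Suprema of Gaussian processes -/

/-! Let `X` be the estimated mixture minus the true one. Minimality, tested against the true
parameters, gives `½‖X‖² + κ(‖β̂‖₁ - ‖β⋆‖₁) ≤ ⟨X, w⟩`. Four errors govern both sides: `I0`, the
mismatch between each true amplitude and the total estimated amplitude near it; `I1` and `I2`, the
first and second moments, in arc length, of the estimated amplitudes about the true locations; `I3`,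
the far mass.

Pairing `X` with certificates, whose norms are `O(√s)`, controls these errors. With the signs of
`β⋆`, an interpolating certificate shows that `‖β̂‖₁ - ‖β⋆‖₁` dominates `I2 + I3` up to `√s‖X‖`;
with the signs of the mismatches it bounds `I0`. A derivative certificate bounds `I1`. A
second-order expansion of `⟨φ(·), w⟩` in arc length bounds `⟨X, w⟩` by `I0 + I1 + I2 + I3` times the
supremum of the noise against the covariant derivatives of orders 0, 1, 2. When that supremum is at
most `cκ` with `c` small, `I2 + I3` is absorbed, `‖X‖ = O(κ√s)`, and every error is `O(κs)`
(`scalar_bounds`, `estimation_bounds`).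

The suprema are those of Gaussian processes that are Lipschitz in quadratic mean in arc length, as
the norms of the covariant derivatives up to order 3 are read off the diagonals of `K^{[2,2]}` and
`K^{[3,3]}` (`norm_covFeature_le`). On a unit interval the sum of absolute dyadic increments is an
average of absolute Gaussians, hence has Gaussian tails at every scale with the same constant
(`measure_oscillation_le`). A union bound over unit intervals produces the factor `|Θ_T| + 1`. -/

theorem integrable_exp_mul_abs_of_gaussian {Ω : Type*} [MeasurableSpace Ω] {P : Measure Ω}
    {X : Ω → ℝ} {V : NNReal} (hX : HasLaw X (gaussianReal 0 V) P) (l : ℝ) :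
    Integrable (fun ω => Real.exp (l * |X ω|)) P ∧
      ∫ ω, Real.exp (l * |X ω|) ∂P ≤ 2 * Real.exp (V * l ^ 2 / 2) := by
  have hint : ∀ t : ℝ, Integrable (fun ω => Real.exp (t * X ω)) P := fun t => by
    have h := integrable_exp_mul_gaussianReal (μ := 0) (v := V) t
    rw [← hX.map_eq] at h
    exact h.comp_aemeasurable hX.aemeasurable
  have hval : ∀ t : ℝ, ∫ ω, Real.exp (t * X ω) ∂P = Real.exp (V * t ^ 2 / 2) := fun t => by
    have h := mgf_gaussianReal hX.map_eq t
    simpa [mgf] using h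
  have hle : ∀ ω, Real.exp (l * |X ω|) ≤ Real.exp (l * X ω) + Real.exp (-l * X ω) := fun ω => by
    rcases abs_choice (X ω) with h | h <;> rw [h]
    · linarith [Real.exp_pos (-l * X ω)]
    · rw [show l * -X ω = -l * X ω by ring]
      linarith [Real.exp_pos (l * X ω)]
  have hi : Integrable (fun ω => Real.exp (l * |X ω|)) P := by
    refine ((hint l).add (hint (-l))).mono' ?_ (ae_of_all _ fun ω => ?_)
    · have hm := hX.aemeasurable
      exact (Real.measurable_exp.comp_aemeasurable
        ((continuous_abs.measurable.comp_aemeasurable hm).const_mul l)).aestronglyMeasurable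
    · rw [Real.norm_eq_abs, abs_of_pos (Real.exp_pos _)]
      exact hle ω
  refine ⟨hi, (integral_mono hi ((hint l).add (hint (-l))) hle).trans_eq ?_⟩
  have h := integral_add (hint l) (hint (-l))
  simp only [Pi.add_apply]
  rw [h, hval, hval, neg_sq]
  ring

/-- Chernoff's bound. By Jensen's inequality the exponential moment of an average is at most the
average of the exponential moments, so neither independence nor joint normality is needed and the
bound is free of `n`. -/
theorem measure_average_abs_ge_le {Ω : Type*} [MeasurableSpace Ω] {P : Measure Ω}
    [IsProbabilityMeasure P] {n : ℕ} (hn : 0 < n) {X : ℕ → Ω → ℝ} {m u : ℝ} (hm : 0 < m)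
    (hX : ∀ k < n, ∃ V : NNReal, HasLaw (X k) (gaussianReal 0 V) P ∧ (V : ℝ) ≤ m)
    (hu : 0 ≤ u) :
    P.real {ω | u ≤ ∑ k ∈ Finset.range n, (n : ℝ)⁻¹ * |X k ω|} ≤
      2 * Real.exp (-(u ^ 2 / (2 * m))) := by
  have hn' : (0 : ℝ) < n := by exact_mod_cast hn
  -- The minimizer of `-l * u + m * l ^ 2 / 2`.
  set l := u / m with hl
  have hl0 : 0 ≤ l := by positivity
  set D : Ω → ℝ := fun ω => ∑ k ∈ Finset.range n, (n : ℝ)⁻¹ * |X k ω|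
  have hk : ∀ k ∈ Finset.range n, Integrable (fun ω => Real.exp (l * |X k ω|)) P ∧
      ∫ ω, Real.exp (l * |X k ω|) ∂P ≤ 2 * Real.exp (m * l ^ 2 / 2) := fun k hk => by
    obtain ⟨V, hV, hVm⟩ := hX k (Finset.mem_range.1 hk)
    obtain ⟨h1, h2⟩ := integrable_exp_mul_abs_of_gaussian hV l
    refine ⟨h1, h2.trans ?_⟩
    gcongr
  have hDm : AEMeasurable D P := by
    refine Finset.aemeasurable_fun_sum _ fun k hk' => ?_
    obtain ⟨V, hV, -⟩ := hX k (Finset.mem_range.1 hk')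
    exact (continuous_abs.measurable.comp_aemeasurable hV.aemeasurable).const_mul _
  have hconv : ∀ ω, Real.exp (l * D ω) ≤
      ∑ k ∈ Finset.range n, (n : ℝ)⁻¹ * Real.exp (l * |X k ω|) := fun ω => by
    have h := convexOn_exp.map_sum_le (t := Finset.range n) (w := fun _ => (n : ℝ)⁻¹)
      (p := fun k => l * |X k ω|) (fun _ _ => by positivity) (by simp [hn'.ne'])
      (fun _ _ => Set.mem_univ _)
    simp only [smul_eq_mul] at h
    refine le_trans (le_of_eq ?_) h
    simp only [D, Finset.mul_sum]
    congr 1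
    exact Finset.sum_congr rfl fun _ _ => by ring
  have hsi : Integrable (fun ω => ∑ k ∈ Finset.range n, (n : ℝ)⁻¹ * Real.exp (l * |X k ω|)) P :=
    integrable_finsetSum _ fun k hk' => (hk k hk').1.const_mul _
  have hDi : Integrable (fun ω => Real.exp (l * D ω)) P := by
    refine hsi.mono' (Real.measurable_exp.comp_aemeasurable
      (hDm.const_mul l)).aestronglyMeasurable (ae_of_all _ fun ω => ?_)
    rw [Real.norm_eq_abs, abs_of_pos (Real.exp_pos _)]
    exact hconv ω
  have hmgf : mgf D P l ≤ 2 * Real.exp (m * l ^ 2 / 2) := by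
    calc mgf D P l
        ≤ ∫ ω, ∑ k ∈ Finset.range n, (n : ℝ)⁻¹ * Real.exp (l * |X k ω|) ∂P :=
          integral_mono hDi hsi hconv
      _ = ∑ k ∈ Finset.range n, (n : ℝ)⁻¹ * ∫ ω, Real.exp (l * |X k ω|) ∂P := by
          rw [integral_finsetSum _ fun k hk' => (hk k hk').1.const_mul _]
          simp_rw [integral_const_mul]
      _ ≤ ∑ k ∈ Finset.range n, (n : ℝ)⁻¹ * (2 * Real.exp (m * l ^ 2 / 2)) :=
          Finset.sum_le_sum fun k hk' => by gcongr; exact (hk k hk').2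
      _ = 2 * Real.exp (m * l ^ 2 / 2) := by
          simp [hn'.ne']
  refine (measure_ge_le_exp_mul_mgf u hl0 hDi).trans ?_
  calc Real.exp (-l * u) * mgf D P l
      ≤ Real.exp (-l * u) * (2 * Real.exp (m * l ^ 2 / 2)) := by gcongr
    _ = 2 * (Real.exp (-l * u) * Real.exp (m * l ^ 2 / 2)) := by ring
    _ = 2 * Real.exp (-(u ^ 2 / (2 * m))) := by
        rw [← Real.exp_add, hl]
        congr 2
        field_simp
        ring

/-- Each cell is halved and the triangle inequality applied. Monotonicity makes the events at
successive scales increase, which replaces a union bound over scales. -/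
theorem sum_dyadic_increments_mono (z : ℝ → ℝ) (c : ℝ) :
    Monotone fun n : ℕ => ∑ k ∈ Finset.range (2 ^ n),
      |z (c + (k + 1 : ℕ) / 2 ^ n) - z (c + (k : ℕ) / 2 ^ n)| := by
  refine monotone_nat_of_le_succ fun n => ?_
  have hsplit : ∀ (f : ℕ → ℝ) (N : ℕ), ∑ k ∈ Finset.range (N * 2), f k =
      ∑ k ∈ Finset.range N, (f (2 * k) + f (2 * k + 1)) := fun f N => by
    induction N with
    | zero => simp
    | succ N ih =>
      rw [Finset.sum_range_succ, ← ih, show (N + 1) * 2 = N * 2 + 1 + 1 by ring,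
        Finset.sum_range_succ, Finset.sum_range_succ, mul_comm N 2]
      ring
  rw [pow_succ 2 n, hsplit]
  refine Finset.sum_le_sum fun k _ => ?_
  have e0 : (((2 * k : ℕ) : ℝ)) / (2 ^ n * 2) = (k : ℕ) / 2 ^ n := by
    push_cast; field_simp
  have e2 : (((2 * k + 1 + 1 : ℕ) : ℝ)) / (2 ^ n * 2) = (k + 1 : ℕ) / 2 ^ n := by
    push_cast; field_simp; ring
  rw [show (2:ℝ) ^ (n + 1) = 2 ^ n * 2 from pow_succ _ _, e0, e2, add_comm (|_|)]
  exact abs_sub_le _ _ _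

theorem abs_sub_le_sum_increments (z : ℕ → ℝ) {j N : ℕ} (hj : j ≤ N) :
    |z j - z 0| ≤ ∑ k ∈ Finset.range N, |z (k + 1) - z k| := by
  rw [← Finset.sum_range_sub z j]
  refine (Finset.abs_sum_le_sum_abs _ _).trans
    (Finset.sum_le_sum_of_subset_of_nonneg (Finset.range_mono hj) fun _ _ _ => abs_nonneg _)

/-- The dyadic point just below `t` is reached from `c` by telescoping, and it tends to `t`. -/
theorem abs_sub_le_of_dyadic {z : ℝ → ℝ} (hz : Continuous z) {c u : ℝ}
    (h : ∀ n : ℕ, ∑ k ∈ Finset.range (2 ^ n),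
      |z (c + (k + 1 : ℕ) / 2 ^ n) - z (c + (k : ℕ) / 2 ^ n)| ≤ u)
    {t : ℝ} (ht : t ∈ Set.Icc c (c + 1)) : |z t - z c| ≤ u := by
  obtain ⟨ht1, ht2⟩ := ht
  have hpow : Filter.Tendsto (fun n : ℕ => (2 : ℝ) ^ n) Filter.atTop Filter.atTop :=
    tendsto_pow_atTop_atTop_of_one_lt one_lt_two
  have hlim := (tendsto_nat_floor_mul_div_atTop (R := ℝ) (a := t - c) (by linarith)).comp hpow
  have hlim2 : Filter.Tendsto
      (fun n : ℕ => |z (c + (⌊(t - c) * 2 ^ n⌋₊ : ℕ) / 2 ^ n) - z c|) Filter.atTop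
      (nhds |z t - z c|) := by
    have h1 : Filter.Tendsto (fun n : ℕ => c + ((⌊(t - c) * 2 ^ n⌋₊ : ℕ) : ℝ) / 2 ^ n)
        Filter.atTop (nhds t) := by
      simpa using hlim.const_add c
    exact (((hz.tendsto t).comp h1).sub_const _).abs
  refine le_of_tendsto hlim2 (Filter.Eventually.of_forall fun n => ?_)
  have hle : ⌊(t - c) * 2 ^ n⌋₊ ≤ 2 ^ n := by
    refine Nat.floor_le_of_le ?_
    push_cast
    have : (0 : ℝ) < 2 ^ n := by positivity
    nlinarith
  have h3 := abs_sub_le_sum_increments (fun k : ℕ => z (c + (k : ℕ) / 2 ^ n)) hle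
  simp only [Nat.cast_zero, zero_div, add_zero] at h3
  exact h3.trans (h n)

/-- A Gaussian process with continuous paths that is Lipschitz in quadratic mean has Gaussian tails
for its oscillation over an interval of length one. -/
theorem measure_oscillation_le {Ω : Type*} [MeasurableSpace Ω] {P : Measure Ω}
    [IsProbabilityMeasure P] {Z : ℝ → Ω → ℝ} {m u : ℝ} (hm : 0 < m) (hu : 0 ≤ u)
    (hcont : ∀ ω, Continuous fun t => Z t ω)
    (hZ : ∀ (s t l : ℝ), ∃ V : NNReal,
      HasLaw (fun ω => l * (Z t ω - Z s ω)) (gaussianReal 0 V) P ∧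
        (V : ℝ) ≤ m * (l * (t - s)) ^ 2) (c : ℝ) :
    P {ω | ∃ t ∈ Set.Icc c (c + 1), u < |Z t ω - Z c ω|} ≤
      ENNReal.ofReal (2 * Real.exp (-(u ^ 2 / (2 * m)))) := by
  set E : ℕ → Set Ω := fun n => {ω | u < ∑ k ∈ Finset.range (2 ^ n),
      |Z (c + (k + 1 : ℕ) / 2 ^ n) ω - Z (c + (k : ℕ) / 2 ^ n) ω|} with hE
  have hmono : Monotone E := fun i j hij ω hω =>
    lt_of_lt_of_le hω (sum_dyadic_increments_mono (fun t => Z t ω) c hij)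
  have hsub : {ω | ∃ t ∈ Set.Icc c (c + 1), u < |Z t ω - Z c ω|} ⊆ ⋃ n, E n := by
    rintro ω ⟨t, ht, hut⟩
    by_contra hcon
    simp only [hE, Set.mem_iUnion, Set.mem_ofPred_eq, not_exists, not_lt] at hcon
    exact absurd (abs_sub_le_of_dyadic (hcont ω) hcon ht) (not_le.2 hut)
  refine (measure_mono hsub).trans ?_
  -- Continuity from below along a monotone sequence; it does not require the sets to be measurable.
  rw [hmono.measure_iUnion]
  refine iSup_le fun n => ?_
  have h2 : (0 : ℝ) < 2 ^ n := by positivity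
  -- The sum of increments is the average of the increments rescaled by `2 ^ n`; since the mesh is
  -- `2 ^ (-n)`, these have variance at most `m`.
  have h := measure_average_abs_ge_le (P := P) (n := 2 ^ n) (by positivity) hm
    (X := fun k ω => 2 ^ n * (Z (c + (k + 1 : ℕ) / 2 ^ n) ω - Z (c + (k : ℕ) / 2 ^ n) ω))
    (fun k _ => by
      obtain ⟨V, hV, hVm⟩ := hZ (c + (k : ℕ) / 2 ^ n) (c + (k + 1 : ℕ) / 2 ^ n) (2 ^ n)
      refine ⟨V, hV, hVm.trans_eq ?_⟩
      push_cast
      field_simp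
      ring) hu
  rw [← ofReal_measureReal (measure_ne_top _ _)]
  refine ENNReal.ofReal_le_ofReal (le_trans (measureReal_mono fun ω hω => ?_) h)
  simp only [hE, Set.mem_ofPred_eq] at hω ⊢
  refine hω.le.trans_eq (Finset.sum_congr rfl fun k _ => ?_)
  rw [abs_mul, abs_of_pos h2, ← mul_assoc]
  push_cast
  rw [inv_mul_cancel₀ h2.ne', one_mul]

/-- Half of the level `2 * u` is spent at the left end of a unit interval, half on the oscillation
over it. The last interval may overshoot `L`, which is harmless for a process indexed by the whole
line. -/
theorem measure_sup_gt_le {Ω : Type*} [MeasurableSpace Ω] {P : Measure Ω}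
    [IsProbabilityMeasure P] {Z : ℝ → Ω → ℝ} {m u : ℝ} (hm : 0 < m) (hu : 0 ≤ u)
    (hcont : ∀ ω, Continuous fun t => Z t ω)
    (hZ0 : ∀ t, ∃ V : NNReal, HasLaw (Z t) (gaussianReal 0 V) P ∧ (V : ℝ) ≤ m)
    (hZ : ∀ (s t l : ℝ), ∃ V : NNReal,
      HasLaw (fun ω => l * (Z t ω - Z s ω)) (gaussianReal 0 V) P ∧
        (V : ℝ) ≤ m * (l * (t - s)) ^ 2) {L : ℝ} (hL : 0 ≤ L) :
    P {ω | ∃ t ∈ Set.Icc 0 L, 2 * u < |Z t ω|} ≤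
      ENNReal.ofReal (4 * (L + 1) * Real.exp (-(u ^ 2 / (2 * m)))) := by
  set e := Real.exp (-(u ^ 2 / (2 * m)))
  have he : 0 < e := Real.exp_pos _
  have hsub : {ω | ∃ t ∈ Set.Icc 0 L, 2 * u < |Z t ω|} ⊆
      ⋃ i ∈ Finset.range (⌊L⌋₊ + 1), ({ω | u ≤ |Z i ω|} ∪
        {ω | ∃ t ∈ Set.Icc (i : ℝ) (i + 1), u < |Z t ω - Z i ω|}) := by
    rintro ω ⟨t, ⟨ht0, htL⟩, h⟩
    simp only [Set.mem_iUnion]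
    refine ⟨⌊t⌋₊, Finset.mem_range.2 (Nat.lt_succ_of_le (Nat.floor_mono htL)), ?_⟩
    by_cases h1 : u ≤ |Z (⌊t⌋₊ : ℝ) ω|
    · exact Or.inl h1
    · refine Or.inr ⟨t, ⟨Nat.floor_le ht0, (Nat.lt_floor_add_one t).le⟩, ?_⟩
      have := abs_sub_abs_le_abs_sub (Z t ω) (Z (⌊t⌋₊ : ℝ) ω)
      push Not at h1
      linarith
  refine (measure_mono hsub).trans ((measure_biUnion_finset_le _ _).trans ?_)
  have hi : ∀ i ∈ Finset.range (⌊L⌋₊ + 1), P ({ω | u ≤ |Z i ω|} ∪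
        {ω | ∃ t ∈ Set.Icc (i : ℝ) (i + 1), u < |Z t ω - Z i ω|}) ≤ ENNReal.ofReal (4 * e) := by
    intro i _
    refine (measure_union_le _ _).trans ?_
    have h1 : P {ω | u ≤ |Z i ω|} ≤ ENNReal.ofReal (2 * e) := by
      have h := measure_average_abs_ge_le (P := P) one_pos hm (X := fun _ => Z i)
        (fun _ _ => hZ0 i) hu
      rw [← ofReal_measureReal (measure_ne_top _ _)]
      exact ENNReal.ofReal_le_ofReal (by simpa using h)
    refine (add_le_add h1 (measure_oscillation_le hm hu hcont hZ i)).trans_eq ?_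
    rw [← ENNReal.ofReal_add (by positivity) (by positivity)]
    congr 1
    ring
  refine (Finset.sum_le_sum hi).trans ?_
  rw [Finset.sum_const, Finset.card_range, nsmul_eq_mul, ← ENNReal.ofReal_natCast,
    ← ENNReal.ofReal_mul (by positivity)]
  refine ENNReal.ofReal_le_ofReal ?_
  push_cast
  nlinarith [Nat.floor_le hL]

theorem measure_noise_sup_gt_le {H : Type u} [NormedAddCommGroup H] [InnerProductSpace ℝ H]
    {Ω : Type v} [MeasurableSpace Ω] {P : Measure Ω} [IsProbabilityMeasure P] {w : Ω → H}
    {σ Δ : ℝ} (hw : AdmissibleNoise P w σ Δ) {f : ℝ → H} {M L u : ℝ} (hM : 0 < M) (hL : 0 ≤ L)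
    (hu : 0 ≤ u) (hf : ∀ t ∈ Set.Icc 0 L, ‖f t‖ ≤ M)
    (hlip : ∀ s ∈ Set.Icc 0 L, ∀ t ∈ Set.Icc 0 L, ‖f t - f s‖ ≤ M * |t - s|) :
    P {ω | ∃ t ∈ Set.Icc 0 L, 2 * u < |inner ℝ (f t) (w ω)|} ≤
      ENNReal.ofReal (4 * (L + 1) * Real.exp (-(u ^ 2 / (2 * (σ ^ 2 * Δ * M ^ 2))))) := by
  have hσ := hw.sigma_pos
  have hΔ := hw.delta_pos
  -- Projecting onto `[0, L]` is 1-Lipschitz, so the extension to the line keeps both bounds.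
  set g : ℝ → H := fun t => f (Set.projIcc 0 L hL t) with hg
  have hglip : ∀ s t, ‖g t - g s‖ ≤ M * |t - s| := fun s t =>
    (hlip _ (Set.projIcc 0 L hL s).2 _ (Set.projIcc 0 L hL t).2).trans (by
      refine mul_le_mul_of_nonneg_left ?_ hM.le
      have := (LipschitzWith.projIcc hL).dist_le_mul t s
      simpa [Subtype.dist_eq, Real.dist_eq] using this)
  have hgcont : Continuous g := by
    refine (LipschitzWith.of_dist_le_mul (K := M.toNNReal) fun t s => ?_).continuous
    rw [dist_eq_norm, Real.dist_eq, Real.coe_toNNReal _ hM.le]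
    exact hglip s t
  have h := measure_sup_gt_le (P := P) (Z := fun t ω => inner ℝ (g t) (w ω))
    (m := σ ^ 2 * Δ * M ^ 2) (u := u) (by positivity) hu
    (fun ω => hgcont.inner continuous_const)
    (fun t => by
      obtain ⟨V, hV, hVm⟩ := hw.gaussian (g t)
      refine ⟨V, hV, hVm.trans ?_⟩
      gcongr
      exact hf _ (Set.projIcc 0 L hL t).2)
    (fun s t l => by
      obtain ⟨V, hV, hVm⟩ := hw.gaussian (l • (g t - g s))
      refine ⟨V, by simpa only [real_inner_smul_left, inner_sub_left] using hV, hVm.trans ?_⟩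
      rw [norm_smul, mul_pow, mul_pow, Real.norm_eq_abs, sq_abs]
      have := pow_le_pow_left₀ (norm_nonneg _) (hglip s t) 2
      rw [mul_pow, sq_abs] at this
      have h3 : 0 ≤ σ ^ 2 * Δ * l ^ 2 := by positivity
      nlinarith [mul_le_mul_of_nonneg_left this h3]) hL
  refine (measure_mono fun ω hω => ?_).trans h
  obtain ⟨t, ht, hωt⟩ := hω
  exact ⟨t, ht, by simpa [hg, Set.projIcc_of_mem hL ht] using hωt⟩

/-! ### Calculus in arc length -/

section ArcLength

variable {E : Type*} [NormedAddCommGroup E] [NormedSpace ℝ E] [CompleteSpace E]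

/-- `ρ` is the speed of the parametrization, so `F'` is the derivative of `F` in arc length; keeping
the weight `ρ` avoids any change of variables. -/
theorem sub_eq_integral_of_hasDerivWithinAt {Θ : Set ℝ} (hΘ : Θ.OrdConnected) {ρ : ℝ → ℝ}
    {F F' : ℝ → E} (hρ : ContinuousOn ρ Θ) (hF' : ContinuousOn F' Θ)
    (hF : ∀ x ∈ Θ, HasDerivWithinAt F (ρ x • F' x) Θ x) {x y : ℝ} (hx : x ∈ Θ) (hy : y ∈ Θ) :
    F y - F x = ∫ t in x..y, ρ t • F' t := by
  have hsub : Set.uIcc x y ⊆ Θ := hΘ.uIcc_subset hx hy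
  refine (intervalIntegral.integral_eq_sub_of_hasDeriv_right
    (fun t ht => (hF t (hsub ht)).continuousWithinAt.mono hsub) (fun t ht => ?_)
    ((hρ.smul hF').mono hsub).intervalIntegrable).symm
  have hnhds : Θ ∈ nhds t :=
    Filter.mem_of_superset (Ioo_mem_nhds ht.1 ht.2) (Set.Ioo_subset_Icc_self.trans hsub)
  exact ((hF t (hsub (Set.Ioo_subset_Icc_self ht))).hasDerivAt hnhds).hasDerivWithinAt

theorem norm_sub_le_of_hasDerivWithinAt {Θ : Set ℝ} (hΘ : Θ.OrdConnected) {ρ : ℝ → ℝ}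
    {F F' : ℝ → E} (hρ : ContinuousOn ρ Θ) (hρ0 : ∀ x ∈ Θ, 0 ≤ ρ x) (hF' : ContinuousOn F' Θ)
    (hF : ∀ x ∈ Θ, HasDerivWithinAt F (ρ x • F' x) Θ x) {x y M : ℝ} (hx : x ∈ Θ) (hy : y ∈ Θ)
    (hM : 0 ≤ M) (hbound : ∀ t ∈ Set.uIcc x y, ‖F' t‖ ≤ M) :
    ‖F y - F x‖ ≤ M * |∫ t in x..y, ρ t| := by
  have hsub : Set.uIcc x y ⊆ Θ := hΘ.uIcc_subset hx hy
  rw [sub_eq_integral_of_hasDerivWithinAt hΘ hρ hF' hF hx hy]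
  have h := intervalIntegral.norm_integral_le_abs_of_norm_le (μ := volume) (a := x) (b := y)
    (f := fun t => ρ t • F' t) (g := fun t => M * ρ t) ?_
    ((hρ.mono hsub).intervalIntegrable.const_mul M)
  · rwa [intervalIntegral.integral_const_mul, abs_mul, abs_of_nonneg hM] at h
  · refine (ae_restrict_iff' measurableSet_uIoc).2 (ae_of_all _ fun t ht => ?_)
    have ht' := Set.uIoc_subset_uIcc ht
    rw [norm_smul, Real.norm_eq_abs, abs_of_nonneg (hρ0 t (hsub ht')), mul_comm]
    exact mul_le_mul_of_nonneg_right (hbound t ht') (hρ0 t (hsub ht'))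

theorem abs_integral_le_of_mem_uIcc {Θ : Set ℝ} (hΘ : Θ.OrdConnected) {ρ : ℝ → ℝ}
    (hρ : ContinuousOn ρ Θ) (hρ0 : ∀ x ∈ Θ, 0 ≤ ρ x) {x y t : ℝ} (hx : x ∈ Θ) (hy : y ∈ Θ)
    (ht : t ∈ Set.uIcc x y) : |∫ z in x..t, ρ z| ≤ |∫ z in x..y, ρ z| := by
  have hsub : Set.uIcc x y ⊆ Θ := hΘ.uIcc_subset hx hy
  refine intervalIntegral.abs_integral_mono_interval
    (Set.uIoc_subset_uIoc_of_uIcc_subset_uIcc ?_) ?_ (hρ.mono hsub).intervalIntegrable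
  · exact Set.uIcc_subset_uIcc_left ht
  · refine (ae_restrict_iff' measurableSet_uIoc).2 (ae_of_all _ fun z hz => ?_)
    exact hρ0 z (hsub (Set.uIoc_subset_uIcc hz))

/-- The first-order bound is applied to `F'` under the integral, and the arc length from `x` to `t`
is bounded by that from `x` to `y`; hence the constant `M` rather than `M / 2`. -/
theorem norm_taylor_le_of_hasDerivWithinAt {Θ : Set ℝ} (hΘ : Θ.OrdConnected) {ρ : ℝ → ℝ}
    {F F' F'' : ℝ → E} (hρ : ContinuousOn ρ Θ) (hρ0 : ∀ x ∈ Θ, 0 ≤ ρ x)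
    (hF'' : ContinuousOn F'' Θ)
    (hF : ∀ x ∈ Θ, HasDerivWithinAt F (ρ x • F' x) Θ x)
    (hF' : ∀ x ∈ Θ, HasDerivWithinAt F' (ρ x • F'' x) Θ x)
    {x y M : ℝ} (hx : x ∈ Θ) (hy : y ∈ Θ)
    (hM : 0 ≤ M) (hbound : ∀ t ∈ Set.uIcc x y, ‖F'' t‖ ≤ M) :
    ‖F y - F x - (∫ t in x..y, ρ t) • F' x‖ ≤ M * (∫ t in x..y, ρ t) ^ 2 := by
  have hsub : Set.uIcc x y ⊆ Θ := hΘ.uIcc_subset hx hy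
  have hF'c : ContinuousOn F' Θ := fun t ht => (hF' t ht).continuousWithinAt
  have hint : ∀ F₁ : ℝ → E, ContinuousOn F₁ Θ →
      IntervalIntegrable (fun t => ρ t • F₁ t) volume x y := fun F₁ h =>
    ((hρ.smul h).mono hsub).intervalIntegrable
  rw [sub_eq_integral_of_hasDerivWithinAt hΘ hρ hF'c hF hx hy,
    ← intervalIntegral.integral_smul_const,
    ← intervalIntegral.integral_sub (hint _ hF'c) (hint _ continuousOn_const)]
  set d := |∫ t in x..y, ρ t| with hd
  have h := intervalIntegral.norm_integral_le_abs_of_norm_le (μ := volume) (a := x) (b := y)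
    (f := fun t => ρ t • F' t - ρ t • F' x) (g := fun t => M * d * ρ t) ?_
    ((hρ.mono hsub).intervalIntegrable.const_mul (M * d))
  · rw [intervalIntegral.integral_const_mul, abs_mul, abs_of_nonneg (by positivity), ← hd,
      mul_assoc, ← sq, hd, sq_abs] at h
    exact h
  · refine (ae_restrict_iff' measurableSet_uIoc).2 (ae_of_all _ fun t ht => ?_)
    have ht' := Set.uIoc_subset_uIcc ht
    rw [← smul_sub, norm_smul, Real.norm_eq_abs, abs_of_nonneg (hρ0 t (hsub ht')), mul_comm]
    refine mul_le_mul_of_nonneg_right ?_ (hρ0 t (hsub ht'))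
    refine (norm_sub_le_of_hasDerivWithinAt hΘ hρ hρ0 hF'' hF' hx (hsub ht') hM
      fun z hz => hbound z (Set.uIcc_subset_uIcc_left ht' hz)).trans ?_
    gcongr
    exact abs_integral_le_of_mem_uIcc hΘ hρ hρ0 hx hy ht'

theorem exists_arcLength_parametrization {ρ : ℝ → ℝ} {a b : ℝ} (hab : a ≤ b)
    (hρ : ContinuousOn ρ (Set.Icc a b)) :
    ∃ e : ℝ → ℝ, ∀ u ∈ Set.Icc 0 (∫ t in a..b, ρ t), e u ∈ Set.Icc a b ∧ ∫ t in a..e u, ρ t = u := by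
  have hcont : ContinuousOn (fun x => ∫ t in a..x, ρ t) (Set.Icc a b) := by
    rw [← Set.uIcc_of_le hab] at hρ ⊢
    exact intervalIntegral.continuousOn_primitive_interval' hρ.intervalIntegrable
      Set.left_mem_uIcc
  have h := intermediate_value_Icc hab hcont
  simp only [intervalIntegral.integral_same] at h
  choose! e he using h
  exact ⟨e, fun u hu => he hu⟩

end ArcLength

/-! ### Covariant derivatives of the normalized dictionary -/

section Features

variable {H : Type u} [NormedAddCommGroup H] [InnerProductSpace ℝ H]

/-- The covariant derivatives of the normalized dictionary, for its own metric. -/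
noncomputable def covFeature (Θ : Set ℝ) (φ : ℝ → H) : ℕ → ℝ → H
  | 0 => feature φ
  | i + 1 => fun x =>
      (Real.sqrt (kernelG Θ (dictKernel φ) x))⁻¹ • derivWithin (covFeature Θ φ i) Θ x

theorem norm_feature {Θ : Set ℝ} {φ : ℝ → H} (h : RegularDictionary Θ φ) {x : ℝ} (hx : x ∈ Θ) :
    ‖feature φ x‖ = 1 := by
  have := h.norm_pos x hx
  rw [feature, norm_smul, norm_inv, norm_norm, inv_mul_cancel₀ this.ne']

/-- Where unique differentiability fails, `derivWithin` takes its default value `0`, contradicting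
`deriv_pos`. -/
theorem RegularDictionary.uniqueDiffOn {Θ : Set ℝ} {φ : ℝ → H} (h : RegularDictionary Θ φ) :
    UniqueDiffOn ℝ Θ := fun x hx => by
  by_contra hu
  have h0 := h.deriv_pos x hx
  rw [derivWithin_zero_of_not_uniqueDiffWithinAt hu] at h0
  simp at h0

theorem contDiffOn_feature {Θ : Set ℝ} {φ : ℝ → H} (h : RegularDictionary Θ φ) :
    ContDiffOn ℝ 3 (feature φ) Θ := by
  have h0 : ∀ x ∈ Θ, φ x ≠ 0 := fun x hx => norm_pos_iff.1 (h.norm_pos x hx)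
  exact ((h.smooth.norm ℝ h0).inv fun x hx => (h.norm_pos x hx).ne').smul h.smooth

theorem kernelG_dictKernel {Θ : Set ℝ} {φ : ℝ → H} (h : RegularDictionary Θ φ) {x : ℝ}
    (hx : x ∈ Θ) :
    kernelG Θ (dictKernel φ) x = ‖derivWithin (feature φ) Θ x‖ ^ 2 := by
  have hd : DifferentiableWithinAt ℝ (feature φ) Θ x :=
    (contDiffOn_feature h).differentiableOn (by norm_num) x hx
  have hu := h.uniqueDiffOn x hx
  have h1 : ∀ z, partialY Θ (dictKernel φ) z x =
      inner ℝ (feature φ z) (derivWithin (feature φ) Θ x) := fun z => by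
    have := (hasDerivWithinAt_const x Θ (feature φ z)).inner ℝ hd.hasDerivWithinAt
    simpa [partialY, dictKernel] using this.derivWithin hu
  rw [kernelG, partialX]
  simp_rw [h1]
  have := hd.hasDerivWithinAt.inner ℝ
    (hasDerivWithinAt_const x Θ (derivWithin (feature φ) Θ x))
  rw [this.derivWithin hu]
  simp

theorem kernelG_dictKernel_pos {Θ : Set ℝ} {φ : ℝ → H} (h : RegularDictionary Θ φ) {x : ℝ}
    (hx : x ∈ Θ) : 0 < kernelG Θ (dictKernel φ) x := by
  rw [kernelG_dictKernel h hx]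
  exact h.deriv_pos x hx

theorem contDiffOn_sqrt_kernelG {Θ : Set ℝ} {φ : ℝ → H}
    (h : RegularDictionary Θ φ) :
    ContDiffOn ℝ 2 (fun x => Real.sqrt (kernelG Θ (dictKernel φ) x)) Θ := by
  have h1 : ContDiffOn ℝ 2 (derivWithin (feature φ) Θ) Θ :=
    (contDiffOn_feature h).derivWithin h.uniqueDiffOn (by norm_num)
  have h2 : ContDiffOn ℝ 2 (kernelG Θ (dictKernel φ)) Θ :=
    (h1.norm_sq ℝ).congr fun x hx => kernelG_dictKernel h hx
  exact h2.sqrt fun x hx => (kernelG_dictKernel_pos h hx).ne'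

theorem contDiffOn_covFeature {Θ : Set ℝ} {φ : ℝ → H}
    (h : RegularDictionary Θ φ) (i j : ℕ) (hij : i + j = 3) :
    ContDiffOn ℝ j (covFeature Θ φ i) Θ := by
  induction i generalizing j with
  | zero =>
    obtain rfl : j = 3 := by omega
    exact contDiffOn_feature h
  | succ i ih =>
    have h1 : ContDiffOn ℝ j (derivWithin (covFeature Θ φ i) Θ) Θ :=
      (ih (j + 1) (by omega)).derivWithin h.uniqueDiffOn (by norm_cast)
    have h2 := ((contDiffOn_sqrt_kernelG h).inv
      fun x hx => (Real.sqrt_pos.2 (kernelG_dictKernel_pos h hx)).ne')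
    exact (h2.of_le (by exact_mod_cast (by omega : j ≤ 2))).smul h1

theorem hasDerivWithinAt_covFeature {Θ : Set ℝ} {φ : ℝ → H}
    (h : RegularDictionary Θ φ) {i : ℕ} (hi : i ≤ 2) {x : ℝ} (hx : x ∈ Θ) :
    HasDerivWithinAt (covFeature Θ φ i)
      (Real.sqrt (kernelG Θ (dictKernel φ) x) • covFeature Θ φ (i + 1) x) Θ x := by
  have h1 := (contDiffOn_covFeature h i (3 - i) (by omega)).differentiableOn
    (by norm_cast; omega) x hx
  rw [covFeature, smul_inv_smul₀ (Real.sqrt_pos.2 (kernelG_dictKernel_pos h hx)).ne']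
  exact h1.hasDerivWithinAt

/-- Differentiation in one variable passes through the inner product. On the diagonal this turns
kernel bounds into bounds on `‖covFeature Θ φ i x‖ ^ 2`. -/
theorem kernelDeriv_dictKernel {Θ : Set ℝ} {φ : ℝ → H}
    (h : RegularDictionary Θ φ) {i j : ℕ} (hi : i ≤ 3) (hj : j ≤ 3) {x y : ℝ} (hx : x ∈ Θ)
    (hy : y ∈ Θ) :
    kernelDeriv Θ (dictKernel φ) i j x y = inner ℝ (covFeature Θ φ i x) (covFeature Θ φ j y) := by
  have hu := h.uniqueDiffOn
  have hY : ∀ j ≤ 3, ∀ x, ∀ y ∈ Θ, (covY Θ (dictKernel φ))^[j] (dictKernel φ) x y =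
      inner ℝ (feature φ x) (covFeature Θ φ j y) := by
    intro j
    induction j with
    | zero => intro _ x y _; rfl
    | succ j ih =>
      intro hj x y hy
      have hs := (Real.sqrt_pos.2 (kernelG_dictKernel_pos h hy)).ne'
      rw [Function.iterate_succ_apply', covY, partialY,
        derivWithin_congr (f := fun t => inner ℝ (feature φ x) (covFeature Θ φ j t))
          (fun t ht => ih (by omega) x t ht) (ih (by omega) x y hy)]
      have := (hasDerivWithinAt_const y Θ (feature φ x)).inner ℝ
        (hasDerivWithinAt_covFeature h (by omega : j ≤ 2) hy)
      rw [this.derivWithin (hu y hy), inner_zero_left, add_zero, inner_smul_right,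
        mul_div_cancel_left₀ _ hs]
  have hX : ∀ i ≤ 3, ∀ x ∈ Θ, (covX Θ (dictKernel φ))^[i]
      ((covY Θ (dictKernel φ))^[j] (dictKernel φ)) x y =
      inner ℝ (covFeature Θ φ i x) (covFeature Θ φ j y) := by
    intro i
    induction i with
    | zero => intro _ x _; exact hY j hj x y hy
    | succ i ih =>
      intro hi x hx
      have hs := (Real.sqrt_pos.2 (kernelG_dictKernel_pos h hx)).ne'
      rw [Function.iterate_succ_apply', covX, partialX,
        derivWithin_congr (f := fun t => inner ℝ (covFeature Θ φ i t) (covFeature Θ φ j y))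
          (fun t ht => ih (by omega) t ht) (ih (by omega) x hx)]
      have := (hasDerivWithinAt_covFeature h (by omega : i ≤ 2) hx).inner ℝ
        (hasDerivWithinAt_const x Θ (covFeature Θ φ j y))
      rw [this.derivWithin (hu x hx), inner_zero_right, zero_add, real_inner_smul_left,
        mul_div_cancel_left₀ _ hs]
  exact hX i hi x hx

theorem norm_covFeature_one {Θ : Set ℝ} {φ : ℝ → H} (h : RegularDictionary Θ φ) {x : ℝ}
    (hx : x ∈ Θ) : ‖covFeature Θ φ 1 x‖ = 1 := by
  have h0 := h.deriv_pos x hx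
  have h1 : 0 < ‖derivWithin (feature φ) Θ x‖ := by
    refine (norm_nonneg _).lt_of_ne fun h2 => ?_
    rw [← h2] at h0
    norm_num at h0
  simp only [covFeature]
  rw [kernelG_dictKernel h hx, Real.sqrt_sq h1.le, norm_smul, norm_inv, norm_norm,
    inv_mul_cancel₀ h1.ne']

/-- The first covariant derivatives of the dictionary are bounded in terms of the limit kernel. -/
theorem norm_covFeature_le {Θ Θinf ΘT : Set ℝ} {φ : ℝ → H}
    (h : RegularDictionary Θ φ) {Kinf : ℝ → ℝ → ℝ} {L22 L3 : ℝ}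
    (h22 : supDeriv Θ Θinf Kinf 2 2 = (L22 : EReal)) (h3 : supH Θ Θinf Kinf = (L3 : EReal))
    (hT : ΘT ⊆ Θinf) (hinf : Θinf ⊆ Θ)
    (hgap : kernelGap Θ ΘT (dictKernel φ) Kinf
      ≤ min (supDeriv Θ Θinf Kinf 2 2) (supH Θ Θinf Kinf))
    {i : ℕ} (hi : i ≤ 3) {x : ℝ} (hx : x ∈ ΘT) :
    ‖covFeature Θ φ i x‖ ≤ 1 + 2 * |L22| + 2 * |L3| := by
  have hxΘ := hinf (hT hx)
  have a1 := abs_nonneg L22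
  have a2 := abs_nonneg L3
  have a3 := le_abs_self L22
  have a4 := le_abs_self L3
  have hsq : ∀ n : ℝ, 0 ≤ n → n ^ 2 ≤ 2 * |L22| + 2 * |L3| → n ≤ 1 + 2 * |L22| + 2 * |L3| :=
    fun n _ hn2 => by nlinarith [sq_nonneg (n - 1)]
  rw [h22, h3, kernelGap, max_le_iff] at hgap
  interval_cases i
  · have := norm_feature h hxΘ
    rw [covFeature, this]
    linarith
  · rw [norm_covFeature_one h hxΘ]
    linarith
  -- The squared norm is the diagonal value of `K_T^{[2,2]}`: at most `L22` from the limit kernel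
  -- plus at most `L22` from the proximity. Order 3 is handled likewise with `h` and `L3`.
  · refine hsq _ (norm_nonneg _) ?_
    rw [← real_inner_self_eq_norm_sq, ← kernelDeriv_dictKernel h (by norm_num) (by norm_num) hxΘ hxΘ]
    have b1 : ((|kernelDeriv Θ Kinf 2 2 x x| : ℝ) : EReal) ≤ L22 := by
      rw [← h22]
      exact (le_iSup₂ (f := fun y (_ : y ∈ Θinf) => ((|kernelDeriv Θ Kinf 2 2 x y| : ℝ) : EReal))
        x (hT hx)).trans (le_iSup₂ (f := fun z (_ : z ∈ Θinf) => ⨆ y ∈ Θinf,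
          ((|kernelDeriv Θ Kinf 2 2 z y| : ℝ) : EReal)) x (hT hx))
    have b2 : ((|kernelDeriv Θ (dictKernel φ) 2 2 x x - kernelDeriv Θ Kinf 2 2 x x| : ℝ) : EReal)
        ≤ L22 := by
      refine le_trans ?_ (hgap.1.trans (min_le_left _ _))
      refine le_trans ?_ (le_iSup₂ (2 : Fin 3) (2 : Fin 3))
      exact (le_iSup₂ (f := fun y (_ : y ∈ ΘT) => ((|kernelDeriv Θ (dictKernel φ) 2 2 x y -
        kernelDeriv Θ Kinf 2 2 x y| : ℝ) : EReal)) x hx).trans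
        (le_iSup₂ (f := fun z (_ : z ∈ ΘT) => ⨆ y ∈ ΘT,
          ((|kernelDeriv Θ (dictKernel φ) 2 2 z y - kernelDeriv Θ Kinf 2 2 z y| : ℝ) : EReal)) x hx)
    rw [EReal.coe_le_coe_iff] at b1 b2
    linarith [le_abs_self (kernelDeriv Θ Kinf 2 2 x x), le_abs_self
      (kernelDeriv Θ (dictKernel φ) 2 2 x x - kernelDeriv Θ Kinf 2 2 x x)]
  · refine hsq _ (norm_nonneg _) ?_
    rw [← real_inner_self_eq_norm_sq, ← kernelDeriv_dictKernel h le_rfl le_rfl hxΘ hxΘ]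
    have b1 : ((kernelH Θ Kinf x : ℝ) : EReal) ≤ L3 := by
      rw [← h3]
      exact le_iSup₂ (f := fun y (_ : y ∈ Θinf) => ((kernelH Θ Kinf y : ℝ) : EReal)) x (hT hx)
    have b2 : ((|kernelH Θ (dictKernel φ) x - kernelH Θ Kinf x| : ℝ) : EReal) ≤ L3 := by
      refine le_trans ?_ (hgap.2.trans (min_le_right _ _))
      exact le_iSup₂ (f := fun y (_ : y ∈ ΘT) =>
        ((|kernelH Θ (dictKernel φ) y - kernelH Θ Kinf y| : ℝ) : EReal)) x hx
    rw [EReal.coe_le_coe_iff] at b1 b2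
    rw [kernelH] at b1 b2
    rw [kernelH] at b2
    linarith [le_abs_self (kernelDeriv Θ (dictKernel φ) 3 3 x x - kernelDeriv Θ Kinf 3 3 x x)]

end Features

/-! ### Deterministic estimation bounds -/

section Deterministic

variable {K : ℕ} {H : Type u} [NormedAddCommGroup H] [InnerProductSpace ℝ H]

theorem sum_eq_near_add_far {S : Finset (Fin K)} {N : Fin K → Finset (Fin K)}
    (hN : (S : Set (Fin K)).PairwiseDisjoint N) (x : Fin K → ℝ) :
    ∑ l, x l = ∑ k ∈ S, ∑ l ∈ N k, x l + ∑ l ∈ (S.biUnion N)ᶜ, x l := by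
  rw [← Finset.sum_biUnion hN, Finset.sum_add_sum_compl]

theorem abs_near_sum_le {S : Finset (Fin K)} {N : Fin K → Finset (Fin K)} {β : Fin K → ℝ}
    {z D : Fin K → Fin K → ℝ} {c : ℝ}
    (h : ∀ k ∈ S, ∀ l ∈ N k, |z k l| ≤ c * D k l ^ 2) :
    |∑ k ∈ S, ∑ l ∈ N k, β l * z k l| ≤ c * ∑ k ∈ S, ∑ l ∈ N k, |β l| * D k l ^ 2 := by
  rw [Finset.mul_sum]
  refine (Finset.abs_sum_le_sum_abs _ _).trans (Finset.sum_le_sum fun k hk => ?_)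
  rw [Finset.mul_sum]
  refine (Finset.abs_sum_le_sum_abs _ _).trans (Finset.sum_le_sum fun l hl => ?_)
  rw [abs_mul]
  nlinarith [mul_le_mul_of_nonneg_left (h k hk l hl) (abs_nonneg (β l))]

theorem abs_far_sum_le {U : Finset (Fin K)} {β z : Fin K → ℝ} {c : ℝ}
    (h : ∀ l ∈ U, β l ≠ 0 → |z l| ≤ c) :
    |∑ l ∈ U, β l * z l| ≤ c * ∑ l ∈ U, |β l| := by
  rw [Finset.mul_sum]
  refine (Finset.abs_sum_le_sum_abs _ _).trans (Finset.sum_le_sum fun l hl => ?_)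
  rcases eq_or_ne (β l) 0 with h0 | h0
  · simp [h0]
  · rw [abs_mul, mul_comm]
    exact mul_le_mul_of_nonneg_right (h l hl h0) (abs_nonneg _)

/-- Unlike `Real.sign`, the sign is never `0`, as certificates only accept patterns in `{-1, 1}`. -/
theorem exists_sign_mul_eq_abs (x : ℝ) : ∃ ε : ℝ, (ε = 1 ∨ ε = -1) ∧ ε * x = |x| := by
  rcases abs_choice x with h | h
  · exact ⟨1, Or.inl rfl, by rw [h, one_mul]⟩
  · exact ⟨-1, Or.inr rfl, by rw [h, neg_one_mul]⟩

/-- Bounds for the scalar quantities of the estimation problem: `R` is the prediction error, `B` its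
product with the square root of the sparsity, `nh` and `ns` are the `ℓ¹` norms, and `I0`, `I1`,
`I2`, `I3` are the errors on the amplitudes, on the locations, and the far mass. -/
theorem scalar_bounds {CN CN' CF CB cN cF cB c κ R t I0 I1 I2 I3 nh ns X : ℝ}
    (hCN : 0 < CN) (hCN' : 0 < CN') (hCF : 0 < CF) (hCB : 0 < CB)
    (hcN : 0 < cN) (hcF : 0 < cF) (hcB : 0 < cB) (hκ : 0 < κ) (hR : 0 ≤ R) (ht : 0 ≤ t)
    (hI2 : 0 ≤ I2) (hI3 : 0 ≤ I3) {m A E T : ℝ}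
    (hm : m = min CN CF) (hA : A = 1 + CN' + cN + cF) (hc : c = m / (4 * A)) (hm1 : m ≤ 1)
    (hE : E = 2 * CB + cB) (hT : T = 4 * E ^ 2 / m)
    (h1 : ns + CN * I2 + CF * I3 ≤ nh + CB * (t * R))
    (h2 : I0 ≤ CB * (t * R) + CN' * I2 + I3)
    (h3 : I1 ≤ cB * (t * R) + cN * I2 + cF * I3)
    (h4 : X ≤ c * κ * (I0 + I1 + I2 + I3))
    (h5 : 1 / 2 * R ^ 2 + κ * (nh - ns) ≤ X) :
    I2 + I3 ≤ T * κ * t ^ 2 ∧ I0 ≤ (2 * CB * E + A * T) * κ * t ^ 2 ∧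
      nh - ns ≤ (2 * E ^ 2 + 2 * A * T) * κ * t ^ 2 := by
  have hm0 : 0 < m := hm ▸ lt_min hCN hCF
  have hmN : m ≤ CN := hm ▸ min_le_left _ _
  have hmF : m ≤ CF := hm ▸ min_le_right _ _
  have hA1 : 1 ≤ A := by rw [hA]; linarith
  have hE0 : 0 < E := by rw [hE]; positivity
  have hc0 : 0 < c := by rw [hc]; positivity
  have hcA : c * A = m / 4 := by rw [hc]; field_simp
  have hc1 : c ≤ 1 := by linarith [le_mul_of_one_le_right hc0.le hA1]
  have hB : 0 ≤ t * R := mul_nonneg ht hR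
  have hsum : I0 + I1 + I2 + I3 ≤ (CB + cB) * (t * R) + 2 * A * (I2 + I3) := by
    rw [hA]
    linarith [mul_nonneg hCN'.le hI3, mul_nonneg hcF.le hI2, mul_nonneg hcN.le hI3,
      mul_nonneg hcN.le hI2, mul_nonneg hcF.le hI3, mul_nonneg hCN'.le hI2]
  -- The choice `c = m / (4 * A)` makes the noise cost `m / 2 * (I2 + I3)`, half of what `h7`
  -- provides.
  have h6 : 1 / 2 * R ^ 2 + κ * (nh - ns) ≤
      κ * ((CB + cB) * (t * R) + m / 2 * (I2 + I3)) := by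
    have : c * (I0 + I1 + I2 + I3) ≤ (CB + cB) * (t * R) + m / 2 * (I2 + I3) := by
      have e1 := mul_le_mul_of_nonneg_left hsum hc0.le
      have e2 : c * ((CB + cB) * (t * R)) ≤ 1 * ((CB + cB) * (t * R)) := by gcongr
      have e3 : c * (2 * A * (I2 + I3)) = m / 2 * (I2 + I3) := by
        linear_combination 2 * (I2 + I3) * hcA
      linarith
    linarith [mul_le_mul_of_nonneg_left this hκ.le]
  have h7 : m * (I2 + I3) ≤ nh - ns + CB * (t * R) := by
    linarith [mul_le_mul_of_nonneg_right hmN hI2, mul_le_mul_of_nonneg_right hmF hI3]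
  -- In `E`, one `CB` comes from `I0`, the other from `h7`, and `cB` from `I1`. Dropping either term
  -- on the left bounds `R` or `I2 + I3`.
  have h8 : 1 / 2 * R ^ 2 + κ * (m / 2 * (I2 + I3)) ≤ κ * (E * (t * R)) := by
    rw [hE]
    linarith [mul_le_mul_of_nonneg_left h7 hκ.le]
  have hI23 : 0 ≤ κ * (m / 2 * (I2 + I3)) := by positivity
  have hRle : R ≤ 2 * κ * E * t := by
    rcases hR.eq_or_lt with h0 | h0
    · rw [← h0]; positivity
    · refine le_of_mul_le_mul_right ?_ h0
      linarith
  have hBle : t * R ≤ 2 * E * κ * t ^ 2 := by linarith [mul_le_mul_of_nonneg_left hRle ht]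
  have hI : I2 + I3 ≤ T * κ * t ^ 2 := by
    have e1 : m / 2 * (I2 + I3) ≤ E * (t * R) := by
      refine le_of_mul_le_mul_left ?_ hκ
      linarith [sq_nonneg R]
    have e2 : E * (t * R) ≤ E * (2 * E * κ * t ^ 2) := by gcongr
    have e3 : T * κ * t ^ 2 = 4 * E ^ 2 * κ * t ^ 2 / m := by rw [hT]; ring
    rw [e3, le_div_iff₀ hm0]
    linarith
  refine ⟨hI, ?_, ?_⟩
  · have e1 : CB * (t * R) ≤ CB * (2 * E * κ * t ^ 2) := by gcongr
    have e2 : A * (I2 + I3) ≤ A * (T * κ * t ^ 2) := by gcongr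
    have e3 : CN' * I2 + I3 ≤ A * (I2 + I3) := by
      rw [hA]
      linarith [mul_nonneg hCN'.le hI3, mul_nonneg hcF.le hI2, mul_nonneg hcN.le hI3,
        mul_nonneg hcN.le hI2, mul_nonneg hcF.le hI3]
    linarith
  · have e0 : nh - ns ≤ (CB + cB) * (t * R) + m / 2 * (I2 + I3) := by
      refine le_of_mul_le_mul_left ?_ hκ
      linarith [sq_nonneg R]
    have e1 : (CB + cB) * (t * R) ≤ E * (2 * E * κ * t ^ 2) := by
      have : CB + cB ≤ E := by rw [hE]; linarith
      gcongr
    have e2 : m / 2 * (I2 + I3) ≤ 2 * A * (T * κ * t ^ 2) := by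
      have : m / 2 ≤ 2 * A := by linarith
      gcongr
    linarith

/-- Estimation bounds for a penalized estimator, given certificates and a bound on the noise. -/
theorem estimation_bounds {S : Finset (Fin K)} {N : Fin K → Finset (Fin K)}
    (hN : (S : Set (Fin K)).PairwiseDisjoint N) {f g : Fin K → H} {βh βs : Fin K → ℝ}
    {D : Fin K → Fin K → ℝ} {w : H} {CN CN' CF CB cN cF cB c κ t : ℝ}
    (hCN : 0 < CN) (hCN' : 0 < CN') (hCF : 0 < CF) (hCF1 : CF < 1) (hCB : 0 < CB)
    (hcN : 0 < cN) (hcF : 0 < cF) (hcB : 0 < cB) (hκ : 0 < κ) (ht : 0 ≤ t) {m A E T : ℝ}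
    (hm : m = min CN CF) (hA : A = 1 + CN' + cN + cF) (hc : c = m / (4 * A))
    (hE : E = 2 * CB + cB) (hT : T = 4 * E ^ 2 / m)
    (hopt : 1 / 2 * ‖w - (∑ l, βh l • f l - ∑ k ∈ S, βs k • g k)‖ ^ 2 + κ * ∑ l, |βh l| ≤
      1 / 2 * ‖w‖ ^ 2 + κ * ∑ k ∈ S, |βs k|)
    (hp : ∀ ε : Fin K → ℝ, (∀ k ∈ S, ε k = 1 ∨ ε k = -1) → ∃ p : H,
      (∀ k ∈ S, ∀ l ∈ N k, |inner ℝ (f l) p| ≤ 1 - CN * D k l ^ 2) ∧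
      (∀ k ∈ S, ∀ l ∈ N k, |inner ℝ (f l) p - ε k| ≤ CN' * D k l ^ 2) ∧
      (∀ k ∈ S, inner ℝ (g k) p = ε k) ∧
      (∀ l ∈ (S.biUnion N)ᶜ, βh l ≠ 0 → |inner ℝ (f l) p| ≤ 1 - CF) ∧ ‖p‖ ≤ CB * t)
    (hq : ∀ ε : Fin K → ℝ, (∀ k ∈ S, ε k = 1 ∨ ε k = -1) → ∃ q : H,
      (∀ k ∈ S, ∀ l ∈ N k, |inner ℝ (f l) q - ε k * D k l| ≤ cN * D k l ^ 2) ∧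
      (∀ k ∈ S, inner ℝ (g k) q = 0) ∧
      (∀ l ∈ (S.biUnion N)ᶜ, βh l ≠ 0 → |inner ℝ (f l) q| ≤ cF) ∧ ‖q‖ ≤ cB * t)
    {W : Fin K → ℝ} (hw0 : ∀ k ∈ S, |inner ℝ (g k) w| ≤ c * κ) (hw1 : ∀ k ∈ S, |W k| ≤ c * κ)
    (hw2 : ∀ k ∈ S, ∀ l ∈ N k,
      |inner ℝ (f l) w - inner ℝ (g k) w - D k l * W k| ≤ c * κ * D k l ^ 2)
    (hw3 : ∀ l ∈ (S.biUnion N)ᶜ, βh l ≠ 0 → |inner ℝ (f l) w| ≤ c * κ) :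
    ∑ k ∈ S, |(|βs k| - ∑ l ∈ N k, |βh l|)| ≤
        ((2 * E ^ 2 + 2 * A * T) + 2 * (2 * CB * E + A * T)) * κ * t ^ 2 ∧
      ∑ k ∈ S, |βs k - ∑ l ∈ N k, βh l| ≤ (2 * CB * E + A * T) * κ * t ^ 2 ∧
      ∑ l ∈ (S.biUnion N)ᶜ, |βh l| ≤ T * κ * t ^ 2 ∧
      ∑ k ∈ S, ∑ l ∈ N k, |βh l| * D k l ^ 2 ≤ T * κ * t ^ 2 := by
  set X : H := ∑ l, βh l • f l - ∑ k ∈ S, βs k • g k with hXdef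
  set U := (S.biUnion N)ᶜ with hU
  set I0 := ∑ k ∈ S, |βs k - ∑ l ∈ N k, βh l| with hI0
  set I1 := ∑ k ∈ S, |∑ l ∈ N k, βh l * D k l| with hI1
  set I2 := ∑ k ∈ S, ∑ l ∈ N k, |βh l| * D k l ^ 2 with hI2
  set I3 := ∑ l ∈ U, |βh l| with hI3
  have hX : ∀ p : H, inner ℝ X p = ∑ k ∈ S, ∑ l ∈ N k, βh l * inner ℝ (f l) p +
      ∑ l ∈ U, βh l * inner ℝ (f l) p - ∑ k ∈ S, βs k * inner ℝ (g k) p := fun p => by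
    rw [hXdef, inner_sub_left, sum_inner, sum_inner, hU, ← sum_eq_near_add_far hN]
    simp only [real_inner_smul_left]
  have hXp : ∀ {p : H} {C : ℝ}, ‖p‖ ≤ C * t → |inner ℝ X p| ≤ C * (t * ‖X‖) := fun {p C} h =>
    (abs_real_inner_le_norm X p).trans (by nlinarith [mul_le_mul_of_nonneg_left h (norm_nonneg X)])
  have hnorm := sum_eq_near_add_far hN (fun l => |βh l|)
  have h1 : ∑ k ∈ S, |βs k| + CN * I2 + CF * I3 ≤ ∑ l, |βh l| + CB * (t * ‖X‖) := by
    choose ε hε hεs using fun k => exists_sign_mul_eq_abs (βs k)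
    obtain ⟨p, p1, -, p3, p4, p5⟩ := hp ε fun k _ => hε k
    have e1 : ∑ k ∈ S, ∑ l ∈ N k, βh l * inner ℝ (f l) p ≤
        ∑ k ∈ S, ∑ l ∈ N k, |βh l| - CN * I2 := by
      rw [hI2, Finset.mul_sum, ← Finset.sum_sub_distrib]
      refine Finset.sum_le_sum fun k hk => ?_
      rw [Finset.mul_sum, ← Finset.sum_sub_distrib]
      refine Finset.sum_le_sum fun l hl => (le_abs_self _).trans ?_
      rw [abs_mul]
      nlinarith [mul_le_mul_of_nonneg_left (p1 k hk l hl) (abs_nonneg (βh l))]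
    have e2 := (le_abs_self _).trans (abs_far_sum_le (U := U) p4)
    have e3 : ∑ k ∈ S, βs k * inner ℝ (g k) p = ∑ k ∈ S, |βs k| :=
      Finset.sum_congr rfl fun k hk => by rw [p3 k hk, ← hεs k, mul_comm]
    have e4 := (abs_le.1 (hXp p5)).1
    rw [hX p, e3] at e4
    linarith
  have h2 : I0 ≤ CB * (t * ‖X‖) + CN' * I2 + I3 := by
    choose ε hε hεs using fun k => exists_sign_mul_eq_abs (βs k - ∑ l ∈ N k, βh l)
    obtain ⟨p, -, p2, p3, p4, p5⟩ := hp ε fun k _ => hε k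
    have e1 : I0 = -inner ℝ X p + ∑ k ∈ S, ∑ l ∈ N k, βh l * (inner ℝ (f l) p - ε k) +
        ∑ l ∈ U, βh l * inner ℝ (f l) p := by
      have a1 : I0 = ∑ k ∈ S, βs k * inner ℝ (g k) p - ∑ k ∈ S, ∑ l ∈ N k, βh l * ε k := by
        rw [hI0, ← Finset.sum_sub_distrib]
        refine Finset.sum_congr rfl fun k hk => ?_
        rw [← hεs k, p3 k hk, ← Finset.sum_mul]
        ring
      rw [hX p, a1]
      simp only [mul_sub, Finset.sum_sub_distrib]
      ring
    have e2 := (le_abs_self _).trans (abs_near_sum_le (β := βh) p2)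
    have e3 := (le_abs_self _).trans (abs_far_sum_le (U := U) p4)
    have e4 := (abs_le.1 (hXp p5)).1
    have e5 : (1 - CF) * I3 ≤ I3 := by
      have : 0 ≤ I3 := Finset.sum_nonneg fun _ _ => abs_nonneg _
      nlinarith
    linarith
  have h3 : I1 ≤ cB * (t * ‖X‖) + cN * I2 + cF * I3 := by
    choose ε hε hεs using fun k => exists_sign_mul_eq_abs (∑ l ∈ N k, βh l * D k l)
    obtain ⟨q, q1, q2, q3, q4⟩ := hq ε fun k _ => hε k
    have e1 : I1 = inner ℝ X q - ∑ k ∈ S, ∑ l ∈ N k, βh l * (inner ℝ (f l) q - ε k * D k l) -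
        ∑ l ∈ U, βh l * inner ℝ (f l) q := by
      have a1 : I1 = ∑ k ∈ S, ∑ l ∈ N k, βh l * (ε k * D k l) := by
        refine Finset.sum_congr rfl fun k hk => ?_
        rw [← hεs k, Finset.mul_sum]
        exact Finset.sum_congr rfl fun _ _ => by ring
      have a2 : ∑ k ∈ S, βs k * inner ℝ (g k) q = 0 :=
        Finset.sum_eq_zero fun k hk => by rw [q2 k hk, mul_zero]
      rw [hX q, a1, a2]
      simp only [mul_sub, Finset.sum_sub_distrib]
      ring
    have e2 := (abs_le.1 (abs_near_sum_le (β := βh) q1)).1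
    have e3 := (abs_le.1 (abs_far_sum_le (U := U) q3)).1
    have e4 := (le_abs_self _).trans (hXp q4)
    linarith
  -- Expanding each near feature about its true location splits `⟨X, w⟩` into a mass term, a
  -- first-moment term, a Taylor remainder and a far term.
  have h4 : inner ℝ X w ≤ c * κ * (I0 + I1 + I2 + I3) := by
    have e1 : inner ℝ X w = ∑ k ∈ S, -(inner ℝ (g k) w * (βs k - ∑ l ∈ N k, βh l)) +
        ∑ k ∈ S, W k * ∑ l ∈ N k, βh l * D k l +
        ∑ k ∈ S, ∑ l ∈ N k, βh l * (inner ℝ (f l) w - inner ℝ (g k) w - D k l * W k) +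
        ∑ l ∈ U, βh l * inner ℝ (f l) w := by
      have a1 : ∑ k ∈ S, -(inner ℝ (g k) w * (βs k - ∑ l ∈ N k, βh l)) =
          ∑ k ∈ S, ∑ l ∈ N k, βh l * inner ℝ (g k) w - ∑ k ∈ S, βs k * inner ℝ (g k) w := by
        rw [← Finset.sum_sub_distrib]
        refine Finset.sum_congr rfl fun k hk => ?_
        rw [← Finset.sum_mul]
        ring
      have a2 : ∑ k ∈ S, W k * ∑ l ∈ N k, βh l * D k l =
          ∑ k ∈ S, ∑ l ∈ N k, βh l * (D k l * W k) := by
        refine Finset.sum_congr rfl fun k hk => ?_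
        rw [Finset.mul_sum]
        exact Finset.sum_congr rfl fun _ _ => by ring
      rw [hX w, a1, a2]
      simp only [mul_sub, Finset.sum_sub_distrib]
      ring
    have b0 : ∑ k ∈ S, -(inner ℝ (g k) w * (βs k - ∑ l ∈ N k, βh l)) ≤ c * κ * I0 := by
      rw [hI0, Finset.mul_sum]
      refine Finset.sum_le_sum fun k hk => (neg_le_abs _).trans ?_
      rw [abs_mul]
      exact mul_le_mul_of_nonneg_right (hw0 k hk) (abs_nonneg _)
    have b1 : ∑ k ∈ S, W k * ∑ l ∈ N k, βh l * D k l ≤ c * κ * I1 := by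
      rw [hI1, Finset.mul_sum]
      refine Finset.sum_le_sum fun k hk => (le_abs_self _).trans ?_
      rw [abs_mul]
      exact mul_le_mul_of_nonneg_right (hw1 k hk) (abs_nonneg _)
    have b2 := (le_abs_self _).trans (abs_near_sum_le (β := βh) hw2)
    have b3 := (le_abs_self _).trans (abs_far_sum_le (U := U) hw3)
    linarith
  have h5 : 1 / 2 * ‖X‖ ^ 2 + κ * (∑ l, |βh l| - ∑ k ∈ S, |βs k|) ≤ inner ℝ X w := by
    rw [norm_sub_sq_real, real_inner_comm] at hopt
    linarith
  have hI2n : 0 ≤ I2 := Finset.sum_nonneg fun _ _ => Finset.sum_nonneg fun _ _ => by positivity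
  have hI3n : 0 ≤ I3 := Finset.sum_nonneg fun _ _ => abs_nonneg _
  obtain ⟨r1, r2, r3⟩ := scalar_bounds hCN hCN' hCF hCB hcN hcF hcB hκ (norm_nonneg X) ht hI2n hI3n
    hm hA hc (by rw [hm]; exact (min_le_right _ _).trans hCF1.le) hE hT h1 h2 h3 h4 h5
  refine ⟨?_, r2, by linarith, by linarith⟩
  -- `|x| = -x + 2x⁺`, and the positive part of `|βs k| - ∑ |βh l|` is at most the signed mismatch;
  -- after summation the first term is at most `‖β̂‖₁ - ‖β⋆‖₁`.
  have hk : ∀ k ∈ S, |(|βs k| - ∑ l ∈ N k, |βh l|)| ≤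
      (∑ l ∈ N k, |βh l| - |βs k|) + 2 * |βs k - ∑ l ∈ N k, βh l| := fun k _ => by
    have a1 := abs_sub_abs_le_abs_sub (βs k) (∑ l ∈ N k, βh l)
    have a2 := Finset.abs_sum_le_sum_abs βh (N k)
    have a3 := abs_nonneg (βs k - ∑ l ∈ N k, βh l)
    rw [abs_le]
    constructor <;> linarith
  refine (Finset.sum_le_sum hk).trans ?_
  rw [Finset.sum_add_distrib, Finset.sum_sub_distrib, ← Finset.mul_sum]
  linarith

end Deterministic

/-! ### Noise along the dictionary -/

section Noise

variable {H : Type u} [NormedAddCommGroup H] [InnerProductSpace ℝ H]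

theorem dictDist_comm (Θ : Set ℝ) (φ : ℝ → H) (x y : ℝ) :
    dictDist Θ φ x y = dictDist Θ φ y x := by
  rw [dictDist, dictDist, riemDist, riemDist, intervalIntegral.integral_symm, abs_neg]

theorem dictDist_self (Θ : Set ℝ) (φ : ℝ → H) (x : ℝ) : dictDist Θ φ x x = 0 := by
  simp [dictDist, riemDist]

theorem continuousOn_sqrt_kernelG {Θ : Set ℝ} {φ : ℝ → H} (h : RegularDictionary Θ φ) :
    ContinuousOn (fun x => Real.sqrt (kernelG Θ (dictKernel φ) x)) Θ :=
  (contDiffOn_sqrt_kernelG h).continuousOn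

theorem dictDist_triangle {Θ : Set ℝ} (hΘ : Θ.OrdConnected) {φ : ℝ → H}
    (h : RegularDictionary Θ φ) {x y z : ℝ} (hx : x ∈ Θ) (hy : y ∈ Θ) (hz : z ∈ Θ) :
    dictDist Θ φ x z ≤ dictDist Θ φ x y + dictDist Θ φ y z := by
  have hi : ∀ {x y : ℝ}, x ∈ Θ → y ∈ Θ → IntervalIntegrable
      (fun x => Real.sqrt (kernelG Θ (dictKernel φ) x)) volume x y := fun hx hy =>
    ((continuousOn_sqrt_kernelG h).mono (hΘ.uIcc_subset hx hy)).intervalIntegrable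
  rw [dictDist, dictDist, dictDist, riemDist, riemDist, riemDist,
    ← intervalIntegral.integral_add_adjacent_intervals (hi hx hy) (hi hy hz)]
  exact abs_add_le _ _

theorem sign_mul_dictDist (Θ : Set ℝ) (φ : ℝ → H) (x y : ℝ) :
    Real.sign (y - x) * dictDist Θ φ y x =
      ∫ t in x..y, Real.sqrt (kernelG Θ (dictKernel φ) t) := by
  rcases lt_trichotomy x y with hxy | rfl | hxy
  · rw [Real.sign_of_pos (by linarith), one_mul, dictDist_comm, dictDist, riemDist, abs_of_nonneg]
    exact intervalIntegral.integral_nonneg hxy.le fun _ _ => Real.sqrt_nonneg _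
  · simp
  · rw [Real.sign_of_neg (by linarith), dictDist, riemDist, abs_of_nonneg,
      intervalIntegral.integral_symm y x]
    · ring
    · exact intervalIntegral.integral_nonneg hxy.le fun _ _ => Real.sqrt_nonneg _

theorem norm_covFeature_sub_le [CompleteSpace H] {Θ : Set ℝ} (hΘ : Θ.OrdConnected) {φ : ℝ → H}
    (h : RegularDictionary Θ φ) {a b M : ℝ} (hT : Set.Icc a b ⊆ Θ) (hM : 0 ≤ M) {i : ℕ}
    (hi : i ≤ 2) (hbound : ∀ x ∈ Set.Icc a b, ‖covFeature Θ φ (i + 1) x‖ ≤ M) {x y : ℝ}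
    (hx : x ∈ Set.Icc a b) (hy : y ∈ Set.Icc a b) :
    ‖covFeature Θ φ i y - covFeature Θ φ i x‖ ≤ M * dictDist Θ φ x y :=
  norm_sub_le_of_hasDerivWithinAt hΘ (continuousOn_sqrt_kernelG h) (fun _ _ => Real.sqrt_nonneg _)
    (contDiffOn_covFeature h (i + 1) (2 - i) (by omega)).continuousOn
    (fun _ hx => hasDerivWithinAt_covFeature h hi hx) (hT hx) (hT hy) hM
    fun t ht => hbound t (Set.uIcc_subset_Icc hx hy ht)

theorem measure_covFeature_noise_le [CompleteSpace H] {Ω : Type v} [MeasurableSpace Ω]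
    {P : Measure Ω} [IsProbabilityMeasure P] {w : Ω → H} {σ Δ : ℝ} (hw : AdmissibleNoise P w σ Δ)
    {Θ : Set ℝ} (hΘ : Θ.OrdConnected) {φ : ℝ → H} (h : RegularDictionary Θ φ) {a b M u : ℝ}
    (hab : a ≤ b) (hT : Set.Icc a b ⊆ Θ) (hM : 0 < M) (hu : 0 ≤ u) {i : ℕ} (hi : i ≤ 2)
    (h0 : ∀ x ∈ Set.Icc a b, ‖covFeature Θ φ i x‖ ≤ M)
    (h1 : ∀ x ∈ Set.Icc a b, ‖covFeature Θ φ (i + 1) x‖ ≤ M) :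
    P {ω | ∃ x ∈ Set.Icc a b, 2 * u < |inner ℝ (covFeature Θ φ i x) (w ω)|} ≤
      ENNReal.ofReal (4 * (dictDist Θ φ a b + 1) *
        Real.exp (-(u ^ 2 / (2 * (σ ^ 2 * Δ * M ^ 2))))) := by
  set ρ : ℝ → ℝ := fun x => Real.sqrt (kernelG Θ (dictKernel φ) x) with hρ
  have hρc : ContinuousOn ρ (Set.Icc a b) := (continuousOn_sqrt_kernelG h).mono hT
  have hint : ∀ {x y : ℝ}, x ∈ Set.Icc a b → y ∈ Set.Icc a b → IntervalIntegrable ρ volume x y :=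
    fun hx hy => (hρc.mono (Set.uIcc_subset_Icc hx hy)).intervalIntegrable
  have ha : a ∈ Set.Icc a b := Set.left_mem_Icc.2 hab
  have hL : dictDist Θ φ a b = ∫ t in a..b, ρ t :=
    abs_of_nonneg (intervalIntegral.integral_nonneg hab fun _ _ => Real.sqrt_nonneg _)
  have hd : ∀ x ∈ Set.Icc a b, ∀ y ∈ Set.Icc a b,
      dictDist Θ φ x y = |(∫ t in a..y, ρ t) - ∫ t in a..x, ρ t| := fun x hx y hy => by
    rw [intervalIntegral.integral_interval_sub_left (hint ha hy) (hint ha hx)]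
    rfl
  obtain ⟨e, he⟩ := exists_arcLength_parametrization hab hρc
  rw [← hL] at he
  refine (measure_mono fun ω hω => ?_).trans (measure_noise_sup_gt_le hw
    (f := fun t => covFeature Θ φ i (e t)) hM (L := dictDist Θ φ a b) (abs_nonneg _) hu
    (fun t ht => h0 _ (he t ht).1) fun s hs t ht => ?_)
  · obtain ⟨x, hx, hωx⟩ := hω
    have ht : ∫ t in a..x, ρ t ∈ Set.Icc 0 (dictDist Θ φ a b) := by
      rw [hL]
      refine ⟨intervalIntegral.integral_nonneg hx.1 fun _ _ => Real.sqrt_nonneg _, ?_⟩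
      exact intervalIntegral.integral_mono_interval le_rfl hx.1 hx.2
        (ae_of_all _ fun _ => Real.sqrt_nonneg _) (hint ha (Set.right_mem_Icc.2 hab))
    refine ⟨_, ht, ?_⟩
    obtain ⟨he1, he2⟩ := he _ ht
    -- `e` is only a right inverse of arc length, but points at distance zero have the same
    -- covariant derivative.
    have := norm_covFeature_sub_le hΘ h hT hM.le hi h1 hx he1
    rw [hd _ hx _ he1, he2, sub_self, abs_zero, mul_zero] at this
    rwa [sub_eq_zero.1 (norm_le_zero_iff.1 this)]
  · obtain ⟨hs1, hs2⟩ := he s hs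
    obtain ⟨ht1, ht2⟩ := he t ht
    have := norm_covFeature_sub_le hΘ h hT hM.le hi h1 hs1 ht1
    rwa [hd _ hs1 _ ht1, hs2, ht2] at this

theorem abs_noise_taylor_le {Θ : Set ℝ} (hΘ : Θ.OrdConnected) {φ : ℝ → H}
    (h : RegularDictionary Θ φ) {a b M : ℝ} (hT : Set.Icc a b ⊆ Θ) (hM : 0 ≤ M) {w : H}
    (hbound : ∀ x ∈ Set.Icc a b, |inner ℝ (covFeature Θ φ 2 x) w| ≤ M) {x y : ℝ}
    (hx : x ∈ Set.Icc a b) (hy : y ∈ Set.Icc a b) :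
    |inner ℝ (feature φ y) w - inner ℝ (feature φ x) w -
      (∫ t in x..y, Real.sqrt (kernelG Θ (dictKernel φ) t)) * inner ℝ (covFeature Θ φ 1 x) w| ≤
      M * (∫ t in x..y, Real.sqrt (kernelG Θ (dictKernel φ) t)) ^ 2 := by
  have hderiv : ∀ i ≤ 2, ∀ z ∈ Θ, HasDerivWithinAt (fun z => inner ℝ (covFeature Θ φ i z) w)
      (Real.sqrt (kernelG Θ (dictKernel φ) z) • inner ℝ (covFeature Θ φ (i + 1) z) w) Θ z :=
    fun i hi z hz => by
      have := (hasDerivWithinAt_covFeature h hi hz).inner ℝ (hasDerivWithinAt_const z Θ w)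
      simpa [real_inner_smul_left] using this
  exact norm_taylor_le_of_hasDerivWithinAt hΘ (continuousOn_sqrt_kernelG h)
    (fun _ _ => Real.sqrt_nonneg _)
    ((contDiffOn_covFeature h 2 1 rfl).continuousOn.inner continuousOn_const)
    (hderiv 0 (by norm_num)) (hderiv 1 (by norm_num)) (hT hx) (hT hy) hM
    fun t ht => hbound t (Set.uIcc_subset_Icc hx hy ht)

end Noise

/-! ### The estimator -/

section Estimator

variable {K : ℕ} {H : Type u} [NormedAddCommGroup H] [InnerProductSpace ℝ H]

theorem sum_eq_sum_supp {M : Type*} [AddCommMonoid M] {β : Fin K → ℝ} {x : Fin K → M}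
    (h : ∀ k, β k = 0 → x k = 0) : ∑ k, x k = ∑ k ∈ supp β, x k :=
  (Finset.sum_filter_of_ne (p := fun k => β k ≠ 0) fun k _ hk h0 => hk (h k h0)).symm

theorem IsEstimator.objective_le {ΘT : Set ℝ} {φ : ℝ → H} {w : H} {κ : ℝ}
    {βs θs βh θh : Fin K → ℝ} (h : IsEstimator ΘT φ (mixture φ βs θs + w) κ βh θh)
    (hθs : ∀ k, θs k ∈ ΘT) :
    1 / 2 * ‖w - (∑ l, βh l • feature φ (θh l) - ∑ k ∈ supp βs, βs k • feature φ (θs k))‖ ^ 2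
      + κ * ∑ l, |βh l| ≤ 1 / 2 * ‖w‖ ^ 2 + κ * ∑ k ∈ supp βs, |βs k| := by
  have h1 := h.le βs θs hθs
  rw [objective, objective, add_sub_cancel_left] at h1
  rw [← sum_eq_sum_supp (β := βs) fun k hk => by rw [hk, zero_smul],
    ← sum_eq_sum_supp (β := βs) fun k hk => by rw [hk, abs_zero]]
  convert h1 using 4
  simp only [mixture]
  congr 1
  abel

theorem exists_sign_on_points {S : Finset (Fin K)} {θ : Fin K → ℝ} (hθ : Set.InjOn θ S)
    {ε : Fin K → ℝ} (hε : ∀ k ∈ S, ε k = 1 ∨ ε k = -1) :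
    ∃ v : ℝ → ℝ, (∀ t ∈ S.image θ, v t = 1 ∨ v t = -1) ∧ ∀ k ∈ S, v (θ k) = ε k := by
  have hv : ∃ v : ℝ → ℝ, ∀ k ∈ S, v (θ k) = ε k := by
    rcases S.eq_empty_or_nonempty with rfl | ⟨k₀, -⟩
    · exact ⟨0, by simp⟩
    · have : Nonempty (Fin K) := ⟨k₀⟩
      exact ⟨fun t => ε (Function.invFunOn θ S t), fun k hk => congrArg ε (hθ.leftInvOn_invFunOn hk)⟩
  obtain ⟨v, hv⟩ := hv
  refine ⟨v, fun t ht => ?_, hv⟩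
  obtain ⟨k, hk, rfl⟩ := Finset.mem_image.1 ht
  rw [hv k hk]
  exact hε k hk

theorem pairwiseDisjoint_nearAt {Θ ΘT : Set ℝ} (hΘ : Θ.OrdConnected) {φ : ℝ → H}
    (h : RegularDictionary Θ φ) (hT : ΘT ⊆ Θ) {βs θs βh θh : Fin K → ℝ} {s : ℕ} {r : ℝ}
    (hsep : SeparatedSet Θ ΘT φ ((supp βs).image θs) s r) (hinj : Set.InjOn θs (supp βs))
    (hθh : ∀ l, θh l ∈ ΘT) :
    ((supp βs : Finset (Fin K)) : Set (Fin K)).PairwiseDisjoint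
      fun k => nearAt Θ φ r βh θh (θs k) := by
  intro j hj k hk hjk
  refine Finset.disjoint_left.2 fun l hlj hlk => ?_
  have h1 := (Finset.mem_filter.1 hlj).2
  have h2 := (Finset.mem_filter.1 hlk).2
  have mj := Finset.mem_image_of_mem θs (Finset.mem_coe.1 hj)
  have mk := Finset.mem_image_of_mem θs (Finset.mem_coe.1 hk)
  have h3 := hsep.separated _ mj _ mk fun heq => hjk (hinj hj hk heq)
  have h4 := dictDist_triangle hΘ h (hT (hsep.subset _ mj)) (hT (hθh l)) (hT (hsep.subset _ mk))
  rw [dictDist_comm Θ φ (θs j) (θh l)] at h4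
  linarith

/-- On the event that the noise is small along the dictionary and its first two covariant
derivatives, every estimator satisfies the estimation bounds. -/
theorem IsEstimator.bounds {Θ : Set ℝ} (hΘ : Θ.OrdConnected) {φ : ℝ → H}
    (h : RegularDictionary Θ φ) {a b : ℝ} (hT : Set.Icc a b ⊆ Θ) {βs θs βh θh : Fin K → ℝ} {s : ℕ}
    {r CN CN' CF CB cN cF cB c κ m A E T : ℝ} {w : H}
    (hr : 0 < r) (hCN : 0 < CN) (hCN' : 0 < CN') (hCF : 0 < CF) (hCF1 : CF < 1) (hCB : 0 < CB)
    (hcN : 0 < cN) (hcF : 0 < cF) (hcB : 0 < cB) (hκ : 0 < κ)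
    (hm : m = min CN CF) (hA : A = 1 + CN' + cN + cF) (hc : c = m / (4 * A))
    (hE : E = 2 * CB + cB) (hTdef : T = 4 * E ^ 2 / m)
    (hθs : ∀ k, θs k ∈ Set.Icc a b) (hcard : (supp βs).card = s)
    (hsep : SeparatedSet Θ (Set.Icc a b) φ ((supp βs).image θs) s r)
    (hp : HasInterpolatingCertificates Θ (Set.Icc a b) φ ((supp βs).image θs) s r CN CN' CF CB)
    (hq : HasDerivativeCertificates Θ (Set.Icc a b) φ ((supp βs).image θs) s r cN cF cB)
    (hw : ∀ i ≤ 2, ∀ x ∈ Set.Icc a b, |inner ℝ (covFeature Θ φ i x) w| ≤ c * κ)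
    (hest : IsEstimator (Set.Icc a b) φ (mixture φ βs θs + w) κ βh θh) :
    ∑ k ∈ supp βs, |(|βs k| - ∑ l ∈ nearAt Θ φ r βh θh (θs k), |βh l|)|
        ≤ ((2 * E ^ 2 + 2 * A * T) + 2 * (2 * CB * E + A * T)) * κ * s ∧
      ∑ k ∈ supp βs, |βs k - ∑ l ∈ nearAt Θ φ r βh θh (θs k), βh l|
        ≤ (2 * CB * E + A * T) * κ * s ∧
      ∑ l ∈ (nearRegion Θ φ r βs θs βh θh)ᶜ, |βh l| ≤ T * κ * s ∧
      ∑ k ∈ supp βs, ∑ l ∈ nearAt Θ φ r βh θh (θs k),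
        |βh l| * dictDist Θ φ (θh l) (θs k) ^ 2 ≤ T * κ * s := by
  have hinj : Set.InjOn θs (supp βs) :=
    Finset.card_image_iff.1 (hsep.card_eq.trans hcard.symm)
  -- Signed arc length: first-order terms need the sign, and its square is the squared distance.
  set D : Fin K → Fin K → ℝ :=
    fun k l => ∫ t in θs k..θh l, Real.sqrt (kernelG Θ (dictKernel φ) t)
  have hD : ∀ k l, dictDist Θ φ (θs k) (θh l) ^ 2 = D k l ^ 2 := fun k l => sq_abs _
  have hmem : ∀ k ∈ supp βs, θs k ∈ (supp βs).image θs := fun k => Finset.mem_image_of_mem θs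
  have hnear : ∀ k, ∀ l ∈ nearAt Θ φ r βh θh (θs k), dictDist Θ φ (θs k) (θh l) ≤ r :=
    fun k l hl => by rw [dictDist_comm]; exact (Finset.mem_filter.1 hl).2
  have hfar : ∀ l ∈ ((supp βs).biUnion fun k => nearAt Θ φ r βh θh (θs k))ᶜ, βh l ≠ 0 →
      ∀ t ∈ (supp βs).image θs, r < dictDist Θ φ t (θh l) := fun l hl hβ t ht => by
    obtain ⟨k, hk, rfl⟩ := Finset.mem_image.1 ht
    by_contra hcon
    refine Finset.mem_compl.1 hl (Finset.mem_biUnion.2 ⟨k, hk, Finset.mem_filter.2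
      ⟨Finset.mem_filter.2 ⟨Finset.mem_univ _, hβ⟩, ?_⟩⟩)
    rw [dictDist_comm]
    exact not_lt.1 hcon
  have hcκ : 0 ≤ c * κ := (abs_nonneg _).trans (hw 0 (by norm_num) (θs (Classical.choice ?_)) (hθs _))
  swap
  · obtain ⟨k, -⟩ := Finset.card_pos.1 (hcard ▸ hsep.one_le)
    exact ⟨k⟩
  have key := estimation_bounds (S := supp βs) (N := fun k => nearAt Θ φ r βh θh (θs k))
    (pairwiseDisjoint_nearAt hΘ h hT hsep hinj hest.mem) (f := fun l => feature φ (θh l))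
    (g := fun k => feature φ (θs k)) (βh := βh) (βs := βs) (D := D) (w := w) (t := Real.sqrt s)
    hCN hCN' hCF hCF1 hCB hcN hcF hcB hκ (Real.sqrt_nonneg _) hm hA hc hE hTdef
    (hest.objective_le hθs)
    (fun ε hε => by
      obtain ⟨v, hv1, hv2⟩ := exists_sign_on_points hinj hε
      obtain ⟨p, p1, p2, p3, p4⟩ := hp v hv1
      refine ⟨p, fun k hk l hl => ?_, fun k hk l hl => ?_, fun k hk => ?_, fun l hl hβ => ?_, p4⟩
      · rw [← hD]
        exact p1 _ (hmem k hk) _ (hest.mem l) (hnear k l hl)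
      · rw [← hD, ← hv2 k hk]
        exact p2 _ (hmem k hk) _ (hest.mem l) (hnear k l hl)
      -- At distance zero the quadratic bound forces exact interpolation.
      · have := p2 _ (hmem k hk) _ (hθs k) (by rw [dictDist_self]; exact hr.le)
        rw [dictDist_self, hv2 k hk] at this
        exact sub_eq_zero.1 (abs_nonpos_iff.1 (by simpa using this))
      · exact p3 _ (hest.mem l) (hfar l hl hβ))
    (fun ε hε => by
      obtain ⟨v, hv1, hv2⟩ := exists_sign_on_points hinj hε
      obtain ⟨q, q1, q2, q3⟩ := hq v hv1
      refine ⟨q, fun k hk l hl => ?_, fun k hk => ?_, fun l hl hβ => ?_, q3⟩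
      · have := q1 _ (hmem k hk) _ (hest.mem l) (hnear k l hl)
        rwa [hD, mul_assoc, sign_mul_dictDist, hv2 k hk] at this
      · have := q1 _ (hmem k hk) _ (hθs k) (by rw [dictDist_self]; exact hr.le)
        rw [dictDist_self] at this
        exact abs_nonpos_iff.1 (by simpa using this)
      · exact q2 _ (hest.mem l) (hfar l hl hβ))
    (W := fun k => inner ℝ (covFeature Θ φ 1 (θs k)) w)
    (fun k _ => hw 0 (by norm_num) _ (hθs k)) (fun k _ => hw 1 (by norm_num) _ (hθs k))
    (fun k _ l _ => abs_noise_taylor_le hΘ h hT hcκ (hw 2 le_rfl) (hθs k) (hest.mem l))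
    (fun l _ _ => hw 0 (by norm_num) _ (hest.mem l))
  rw [Real.sq_sqrt (Nat.cast_nonneg s)] at key
  refine ⟨key.1, key.2.1, key.2.2.1, ?_⟩
  simp_rw [dictDist_comm Θ φ (θh _), hD]
  exact key.2.2.2

end Estimator

/-- The failure probability of the noise bounds is of the announced order. -/
theorem noise_probability_bound {L τ κ σ Δ M c : ℝ} (hL : 0 ≤ L) (hτ : 1 < τ) (hσ : 0 < σ)
    (hΔ : 0 < Δ) (hM : 0 < M) (hc : 0 < c)
    (hκ : 4 * M / c * σ * Real.sqrt (Δ * Real.log τ) ≤ κ) :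
    12 * (L + 1) * Real.exp (-((c * κ / 2) ^ 2 / (2 * (σ ^ 2 * Δ * M ^ 2)))) ≤
      24 * max (L / (τ * Real.sqrt (Real.log τ))) (1 / τ) := by
  have hlog : 0 < Real.log τ := Real.log_pos hτ
  have hτ0 : 0 < τ := by linarith
  have h1 : 2 * M * σ * Real.sqrt (Δ * Real.log τ) ≤ c * κ / 2 := by
    have := mul_le_mul_of_nonneg_left hκ hc.le
    have e : c * (4 * M / c * σ * Real.sqrt (Δ * Real.log τ)) =
        4 * M * σ * Real.sqrt (Δ * Real.log τ) := by field_simp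
    linarith
  -- The threshold on `κ` yields the decay `τ⁻²`; one factor `τ⁻¹` is then traded for `1 / √(log
  -- τ)`.
  have h2 : 2 * Real.log τ ≤ (c * κ / 2) ^ 2 / (2 * (σ ^ 2 * Δ * M ^ 2)) := by
    rw [le_div_iff₀ (by positivity)]
    refine le_trans (le_of_eq ?_) (pow_le_pow_left₀ (by positivity) h1 2)
    rw [mul_pow, Real.sq_sqrt (by positivity)]
    ring
  have h3 : Real.exp (-((c * κ / 2) ^ 2 / (2 * (σ ^ 2 * Δ * M ^ 2)))) ≤ 1 / τ * (1 / τ) := by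
    refine (Real.exp_le_exp.2 (neg_le_neg h2)).trans_eq ?_
    rw [two_mul, neg_add, Real.exp_add, Real.exp_neg, Real.exp_log hτ0]
    ring
  have h4 : Real.sqrt (Real.log τ) ≤ τ := by
    rw [Real.sqrt_le_left hτ0.le]
    nlinarith [Real.log_le_sub_one_of_pos hτ0]
  have h5 : 1 / τ * (1 / τ) ≤ 1 / τ := by
    have : 1 / τ ≤ 1 := by rw [div_le_one hτ0]; exact hτ.le
    nlinarith [one_div_pos.2 hτ0]
  have h6 : L * (1 / τ * (1 / τ)) ≤ L / (τ * Real.sqrt (Real.log τ)) := by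
    rw [div_eq_mul_inv L, mul_inv, one_div]
    gcongr
  have h7 := le_max_left (L / (τ * Real.sqrt (Real.log τ))) (1 / τ)
  have h8 := le_max_right (L / (τ * Real.sqrt (Real.log τ))) (1 / τ)
  have h9 := mul_le_mul_of_nonneg_left h3 (by positivity : 0 ≤ 12 * (L + 1))
  linarith

theorem theorem2
    (r : ℝ) (hr : 0 < r)
    -- the constants of the certificates
    (CN CN' CF CB cN cF cB : ℝ)
    (hCN : 0 < CN) (hCN' : 0 < CN') (hCF : 0 < CF) (hCF1 : CF < 1) (hCB : 0 < CB)
    (hcN : 0 < cN) (hcF : 0 < cF) (hcB : 0 < cB)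
    -- the two suprema over `Θ∞` through which the limit kernel enters the constants
    (L22 L3 : ℝ) :
    ∃ C1 C2 C3 C4 C5 C6 : ℝ, 0 < C1 ∧ 0 < C2 ∧ 0 < C3 ∧ 0 < C4 ∧ 0 < C5 ∧ 0 < C6 ∧
      ∀ (H : Type u) [NormedAddCommGroup H] [InnerProductSpace ℝ H] [CompleteSpace H]
        (Ω : Type v) [MeasurableSpace Ω] (P : Measure Ω) [IsProbabilityMeasure P]
        -- the parameter intervals, the dictionary and the limit kernel
        (Θ Θinf : Set ℝ) (a b : ℝ) (φ : ℝ → H) (Kinf : ℝ → ℝ → ℝ)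
        -- the model
        (K s : ℕ) (βs θs : Fin K → ℝ) (w y : Ω → H) (σ Δ : ℝ),
        Θ.OrdConnected →
        a ≤ b →
        (∀ k, θs k ∈ Set.Icc a b) →
        (∀ ω, y ω = mixture φ βs θs + w ω) →
        (supp βs).card = s →
        -- admissible noise
        AdmissibleNoise P w σ Δ →
        -- regularity of the dictionary
        RegularDictionary Θ φ →
        -- regularity of the limit kernel
        RegularLimitKernel Θ Θinf Kinf →
        supDeriv Θ Θinf Kinf 2 2 = (L22 : EReal) →
        supH Θ Θinf Kinf = (L3 : EReal) →
        -- proximity to the limit kernel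
        Set.Icc a b ⊆ Θinf →
        kernelGap Θ (Set.Icc a b) (dictKernel φ) Kinf
          ≤ min (supDeriv Θ Θinf Kinf 2 2) (supH Θ Θinf Kinf) →
        -- existence of certificates
        SeparatedSet Θ (Set.Icc a b) φ ((supp βs).image θs) s r →
        HasInterpolatingCertificates Θ (Set.Icc a b) φ ((supp βs).image θs) s r CN CN' CF CB →
        HasDerivativeCertificates Θ (Set.Icc a b) φ ((supp βs).image θs) s r cN cF cB →
        ∀ τ κ : ℝ, 0 < τ → 0 < κ → C1 * σ * Real.sqrt (Δ * Real.log τ) ≤ κ →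
          ∃ A : Set Ω, MeasurableSet A ∧
            1 - C2 * max (dictDist Θ φ a b / (τ * Real.sqrt (Real.log τ))) (1 / τ) ≤ P.real A ∧
            ∀ ω ∈ A, ∀ βh θh : Fin K → ℝ, IsEstimator (Set.Icc a b) φ (y ω) κ βh θh →
              ∑ k ∈ supp βs, |(|βs k| - ∑ l ∈ nearAt Θ φ r βh θh (θs k), |βh l|)|
                  ≤ C3 * κ * s ∧
              ∑ k ∈ supp βs, |βs k - ∑ l ∈ nearAt Θ φ r βh θh (θs k), βh l|
                  ≤ C4 * κ * s ∧
              ∑ l ∈ (nearRegion Θ φ r βs θs βh θh)ᶜ, |βh l| ≤ C5 * κ * s ∧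
              ∑ k ∈ supp βs, ∑ l ∈ nearAt Θ φ r βh θh (θs k),
                  |βh l| * dictDist Θ φ (θh l) (θs k) ^ 2 ≤ C6 * κ * s := by
  set m := min CN CF with hm
  set A := 1 + CN' + cN + cF with hA
  set c := m / (4 * A) with hc
  set E := 2 * CB + cB with hE
  set T := 4 * E ^ 2 / m with hT
  -- `L22` and `L3` are arbitrary reals at this stage; absolute values keep `M` positive.
  set M := 1 + 2 * |L22| + 2 * |L3| with hM
  have hm0 : 0 < m := lt_min hCN hCF
  have hA0 : 0 < A := by positivity
  have hc0 : 0 < c := by positivity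
  have hE0 : 0 < E := by positivity
  have hT0 : 0 < T := by positivity
  have hM0 : 0 < M := by positivity
  refine ⟨4 * M / c, 24, (2 * E ^ 2 + 2 * A * T) + 2 * (2 * CB * E + A * T), 2 * CB * E + A * T, T,
    T, by positivity, by norm_num, by positivity, by positivity, hT0, hT0, ?_⟩
  intro H _ _ _ Ω _ P _ Θ Θinf a b φ Kinf K s βs θs w y σ Δ hΘ hab hθs hy hcard hw hφ hKinf h22 h3
    hTinf hgap hsep hp hq τ κ hτ hκ hκτ
  -- Here the claimed lower bound is at most `0` and the empty event suffices; otherwise `log τ >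
  -- 0`.
  by_cases hτ24 : τ ≤ 24
  · refine ⟨∅, MeasurableSet.empty, ?_, by simp⟩
    have h1 : 1 ≤ 24 * (1 / τ) := by rw [mul_one_div, le_div_iff₀ hτ]; linarith
    have h2 := le_max_right (dictDist Θ φ a b / (τ * Real.sqrt (Real.log τ))) (1 / τ)
    rw [measureReal_empty]
    linarith
  have hTΘ : Set.Icc a b ⊆ Θ := hTinf.trans hKinf.subset
  have hcov : ∀ i ≤ 3, ∀ x ∈ Set.Icc a b, ‖covFeature Θ φ i x‖ ≤ M := fun i hi x hx =>
    norm_covFeature_le hφ h22 h3 hTinf hKinf.subset hgap hi hx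
  set B : Set Ω := ⋃ i ∈ Finset.range 3, {ω | ∃ x ∈ Set.Icc a b,
    2 * (c * κ / 2) < |inner ℝ (covFeature Θ φ i x) (w ω)|} with hB
  have hPB : P.real B ≤ 24 * max (dictDist Θ φ a b / (τ * Real.sqrt (Real.log τ))) (1 / τ) := by
    have hd : 0 ≤ dictDist Θ φ a b := abs_nonneg _
    refine le_trans ?_ (noise_probability_bound hd (by linarith : 1 < τ) hw.sigma_pos hw.delta_pos
      hM0 hc0 hκτ)
    refine ENNReal.toReal_le_of_le_ofReal (by positivity) ((measure_biUnion_finset_le _ _).trans ?_)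
    refine (Finset.sum_le_sum fun i hi => measure_covFeature_noise_le hw hΘ hφ hab hTΘ hM0
      (by positivity : 0 ≤ c * κ / 2) (by have := Finset.mem_range.1 hi; omega)
      (hcov i (by have := Finset.mem_range.1 hi; omega))
      (hcov (i + 1) (by have := Finset.mem_range.1 hi; omega))).trans_eq ?_
    rw [Finset.sum_const, Finset.card_range, nsmul_eq_mul, ← ENNReal.ofReal_natCast,
      ← ENNReal.ofReal_mul (by positivity)]
    congr 1
    push_cast
    ring
  -- `B` is an uncountable union, so it is replaced by a measurable hull of the same measure.
  refine ⟨(toMeasurable P B)ᶜ, (measurableSet_toMeasurable P B).compl, ?_, ?_⟩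
  · rw [probReal_compl_eq_one_sub (measurableSet_toMeasurable P B), measureReal_def,
      measure_toMeasurable, ← measureReal_def]
    linarith
  · intro ω hω βh θh hest
    rw [hy ω] at hest
    refine hest.bounds hΘ hφ hTΘ hr hCN hCN' hCF hCF1 hCB hcN hcF hcB hκ hm hA hc hE hT hθs hcard
      hsep hp hq fun i hi x hx => ?_
    by_contra hcon
    refine hω (subset_toMeasurable P B (Set.mem_biUnion (Finset.mem_coe.2 (Finset.mem_range.2
      (Nat.lt_succ_of_le hi))) ⟨x, hx, ?_⟩))
    rw [mul_div_cancel₀ _ two_ne_zero]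
    exact not_le.1 hcon
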